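/- Consider a fermionic system of $n$ modes with annihilation operators $a_1,\dots,a_n$ on the Fock space of dimension $2^n$, and its Majorana operators $\gamma_{2j-1}=a_j^\dagger+a_j$, $\gamma_{2j}=i(a_j^\dagger-a_j)$, $j=1,\dots,n$. For $S=\{s_1<\dots<s_m\}\subseteq[2n]=\{1,\dots,2n\}$ put $\gamma_S=i^{\binom m2}\gamma_{s_1}\cdots\gamma_{s_m}$. For $0\le\eta\le1$ the unsharp measurement of $\gamma_S$ with sharpness $\eta$ is the POVM $\mathsf M_S^{\eta}(e)=\tfrac12(I+e\,\eta\,\gamma_S)$, $e\in\{\pm1\}$ (for $|S|$ even, $|S|\ge 2$). A POVM $\mathsf G$ with finite outcome set $\Lambda$ *jointly measures* a family of POVMs $(\mathsf M_j)_j$ if for every $j$ there are numbers $0\le D(e\,|\,j,\lambda)\le1$ with $\sum_e D(e\,|\,j,\lambda)=1$ for each $\lambda$, such that $\mathsf M_j(e)=\sum_{\lambda\in\Lambda}D(e\,|\,j,\lambda)\,\mathsf G(\lambda)$ for all outcomes $e$. For such a $\mathsf G$ let $\eta_S(\mathsf G)$ be the maximal $\eta\in[0,1]$ for which $\mathsf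 M_S^\eta$ is obtained from $\mathsf G$ in this way, and let $\eta_{2k}(\mathsf G)=\min\{\eta_S(\mathsf G): S\subseteq[2n],\ |S|=2k\}$. For an orthogonal matrix $O\in O(2n)$ and $R\subseteq[2n]$ let $\gamma_R^O=\sum_{|S|=|R|}\det(O_{R,S})\,\gamma_S$, where $O_{R,S}$ is the submatrix of $O$ with rows $R$ and columns $S$. Let $\mathsf G^O$ be the POVM with outcomes $(q,X)$, $q\in\{\pm1\}^n$, $X\subseteq[2n]$, $$\mathsf G^O(q,X)=(2^{2n})^{n-1}\prod_{j=1}^n \mathsf G^O_{R_j}(q_j,X),\qquad \mathsf G^O_{R_j}(q_j,X)=2^{-2n}\,\gamma_X^\dagger\,\tfrac12\bigl(I+q_j\,\gamma^O_{R_j}\bigr)\gamma_X,\qquad R_j=\{2j-1,2j\}.$$ The uniform randomisation of $\mathsf G^{O^{(1)}},\dots,\mathsf G^{O^{(N)}}$ is the POVM $\mathsf G(r,q,X)=\tfrac1N\,\mathsf G^{O^{(r)}}(q,X)$ with outcomes $(r,q,X)$, $r\in\{1,\dots,N\}$. **Theorem.** (i) For every integer $k\ge1$ there are $c>0$ and $n_0$,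 depending only on $k$, such that for all $n>n_0$ and all $N>4k$ there exist $O^{(1)},\dots,O^{(N)}\in O(2n)$ for which the uniform randomisation $\mathsf G$ of $\mathsf G^{O^{(1)}},\dots,\mathsf G^{O^{(N)}}$ is a POVM that jointly measures all the $\mathsf M_S^{\eta}$, $S\subseteq[2n]$, $|S|=2k$, with the common sharpness $\eta=\eta_{2k}(\mathsf G)$, and $\eta_{2k}(\mathsf G)\ge c\,n^{-k/2}$. (ii) For $k=1$, $N=2$ matrices suffice: there are $c>0$ and $n_0$ such that for all $n>n_0$ there exist $O^{(1)},O^{(2)}\in O(2n)$ for which the uniform randomisation $\mathsf G$ of $\mathsf G^{O^{(1)}},\mathsf G^{O^{(2)}}$ is a POVM that jointly measures all the $\mathsf M_S^{\eta}$, $S\subseteq[2n]$, $|S|=2$, with $\eta=\eta_2(\mathsf G)$, and $\eta_2(\mathsf G)\ge c\,n^{-1/2}$. -/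

import Mathlib

open scoped Matrix ComplexOrder

noncomputable section

namespace FermionicJM

/-! ### Finite-outcome measurements and joint measurability -/

section Measurements

variable {d Λ Ω J : Type*} [Fintype d] [DecidableEq d] [Fintype Λ] [Fintype Ω]

/-- A positive operator-valued measure with finite outcome set `Ω`. -/
def IsPOVM (M : Ω → Matrix d d ℂ) : Prop :=
  (∀ e, (M e).PosSemidef) ∧ ∑ e, M e = 1

/-- `M` is obtained from `G` by a classical post-processing (a stochastic transformation);
`D l e` is the probability of announcing `e` when `G` has given the outcome `l`. -/
def IsPostProcessing (G : Λ → Matrix d d ℂ) (M : Ω → Matrix d d ℂ) : Prop :=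
  ∃ D : Λ → Ω → ℝ,
    (∀ l e, 0 ≤ D l e ∧ D l e ≤ 1) ∧ (∀ l, ∑ e, D l e = 1) ∧
      ∀ e, M e = ∑ l, (D l e : ℂ) • G l

/-- The POVM `G` is a parent of the family of POVMs `M j`: every `M j` is a classical
post-processing of `G`. -/
def JointlyMeasures (G : Λ → Matrix d d ℂ) (M : J → Ω → Matrix d d ℂ) : Prop :=
  IsPOVM G ∧ (∀ j, IsPOVM (M j)) ∧ ∀ j, IsPostProcessing G (M j)

end Measurements

/-! ### Majorana operators on the fermionic Fock space -/

/-- Operators on the Fock space of `n` modes, as matrices in the occupation number basis: the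
basis vector labelled by `T` is the one whose occupied modes are the elements of `T`. -/
abbrev FockOp (n : ℕ) : Type := Matrix (Finset (Fin n)) (Finset (Fin n)) ℂ

/-- The annihilation operator of mode `j`. It sends the basis vector labelled by `T'` to
`(-1) ^ #{i ∈ T' | i < j}` times the one labelled by `T' \ {j}` if `j ∈ T'`, and to `0`
otherwise. -/
def annihilation {n : ℕ} (j : Fin n) : FockOp n :=
  Matrix.of fun T T' =>
    if j ∈ T' ∧ T = T'.erase j then (-1) ^ (T'.filter (· < j)).card else 0

/-- The mode to which the Majorana operator with (zero-based) index `i` belongs. -/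
def mode {n : ℕ} (i : Fin (2 * n)) : Fin n := ⟨i.val / 2, by omega⟩

/-- The `2 n` Majorana operators. Indices start from `0`, so mode `j` carries the operators
`2 j`, which is `a_j† + a_j`, and `2 j + 1`, which is `i (a_j† - a_j)`. -/
def majorana {n : ℕ} (i : Fin (2 * n)) : FockOp n :=
  if i.val % 2 = 0 then (annihilation (mode i))ᴴ + annihilation (mode i)
  else Complex.I • ((annihilation (mode i))ᴴ - annihilation (mode i))

/-- The Majorana monomial `γ_S`: the product of the `γ_j`, `j ∈ S`, in ascending order, times
`i ^ (|S| choose 2)`. -/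
def monomial {n : ℕ} (S : Finset (Fin (2 * n))) : FockOp n :=
  Complex.I ^ (S.card.choose 2) • ((S.sort (· ≤ ·)).map majorana).prod

/-- The index sets of the Majorana observables of degree `m`. -/
abbrev DegSet (n m : ℕ) : Type := {S : Finset (Fin (2 * n)) // S.card = m}

/-- The unsharp measurement of `γ_S` with sharpness `η` and outcomes `±1`. -/
def unsharp {n : ℕ} (S : Finset (Fin (2 * n))) (η : ℝ) (e : ℤˣ) : FockOp n :=
  (1 / 2 : ℂ) • (1 + (((e : ℤ) : ℂ) * (η : ℂ)) • monomial S)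

/-! ### The parent measurement defined by an orthogonal matrix -/

/-- The minor of `O` with rows `R` and columns `S`, both listed in ascending order. -/
def minor {n m : ℕ} (O : Matrix (Fin (2 * n)) (Fin (2 * n)) ℝ) (R S : DegSet n m) : ℝ :=
  (O.submatrix (R.1.orderEmbOfFin R.2) (S.1.orderEmbOfFin S.2)).det

/-- The rotated observable `γ_R^O`, the sum of `det (O_{R,S}) γ_S` over all `S` with
`|S| = |R|`. -/
def rotated {n m : ℕ} (O : Matrix (Fin (2 * n)) (Fin (2 * n)) ℝ) (R : DegSet n m) : FockOp n :=
  ∑ S : DegSet n m, (minor O R S : ℂ) • monomial S.1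

/-- The POVM `G_R^O(q, X) = 2 ^ (-2 n) γ_X† ((1 + q γ_R^O) / 2) γ_X`. -/
def rotatedPOVM {n m : ℕ} (O : Matrix (Fin (2 * n)) (Fin (2 * n)) ℝ) (R : DegSet n m)
    (q : ℤˣ) (X : Finset (Fin (2 * n))) : FockOp n :=
  ((2 : ℂ) ^ (2 * n))⁻¹ •
    ((monomial X)ᴴ * ((1 / 2 : ℂ) • (1 + ((q : ℤ) : ℂ) • rotated O R)) * monomial X)

/-- The two Majorana indices of mode `j`. The sets `modePair j` label the `n` observables of
the computational basis measurement. -/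
def modePair {n : ℕ} (j : Fin n) : DegSet n 2 :=
  ⟨{⟨2 * j.val, by omega⟩, ⟨2 * j.val + 1, by omega⟩}, Finset.card_pair fun h => by
    have := congrArg Fin.val h
    simp at this⟩

/-- The outcomes `(q, X)` of the parent measurement: a string of `n` signs and a subset of the
`2 n` Majorana indices. -/
abbrev Outcome (n : ℕ) : Type := (Fin n → ℤˣ) × Finset (Fin (2 * n))

/-- The parent measurement
`G^O(q, X) = (2 ^ (2 n)) ^ (n - 1) ∏_j G_{R_j}^O(q_j, X)`, where `R_j` is the pair of indices of
mode `j`. The product is taken in the order of the modes. -/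
def parentPOVM {n : ℕ} (O : Matrix (Fin (2 * n)) (Fin (2 * n)) ℝ) (l : Outcome n) : FockOp n :=
  ((2 : ℂ) ^ (2 * n)) ^ (n - 1) •
    (List.ofFn fun j : Fin n => rotatedPOVM O (modePair j) (l.1 j) l.2).prod

/-- The uniform randomisation over `N` parent measurements. The index `r` of the measurement
that was performed is part of the outcome. -/
def randomisedPOVM {n N : ℕ} (O : Fin N → Matrix.orthogonalGroup (Fin (2 * n)) ℝ)
    (l : Fin N × Outcome n) : FockOp n :=
  (N : ℂ)⁻¹ • parentPOVM (O l.1 : Matrix (Fin (2 * n)) (Fin (2 * n)) ℝ) l.2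

/-! ### Sharpness -/

/-- The sharpness `η_S` provided by the parent measurement `G`: the maximal `η ∈ [0, 1]` for
which the unsharp measurement of `γ_S` with sharpness `η` is a post-processing of `G`. -/
def sharpness {n : ℕ} {Λ : Type*} [Fintype Λ] (G : Λ → FockOp n) (S : Finset (Fin (2 * n))) :
    ℝ :=
  sSup {η : ℝ | 0 ≤ η ∧ η ≤ 1 ∧ IsPostProcessing G (unsharp S η)}

/-- The sharpness of `G` for all Majorana observables of degree `m`, the minimum of the `η_S`
over all `S` with `|S| = m`. -/
def minSharpness {n : ℕ} (m : ℕ) {Λ : Type*} [Fintype Λ] (G : Λ → FockOp n) : ℝ :=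
  ⨅ S : DegSet n m, sharpness G S.1

end FermionicJM

end

/-! One explicit orthogonal matrix, the odd-frequency Fourier matrix `oddFourier`, serves every
degree `2 k` with `k ≤ n`. Taking all `N` matrices equal to it proves both parts
(`jointlyMeasures_oddFourier`).

Since rotated Majorana operators obey the Clifford relations, the product of the pair observables
`γ_{R_j}^O` over a set `A` of modes is a combination of the monomials of degree `2 |A|` whose
coefficients are minors of `O`. Weighting the outcomes `X` by the character `(-1) ^ |S ∩ X|` removes
every monomial except `γ_S`. What is left is `γ_S` times `2 ^ (-n) f_S(q)`, with `f_S` a homogeneous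
polynomial of degree `k` in the signs `q`, whose coefficients are the minors `pairMinor O S A`.
Responding with the sign of `f_S(q)` times the character yields the sharpness `E |f_S(q)|` for
uniform `q` (`isPostProcessing_parentPOVM`).

Hypercontractivity bounds the fourth moment of `f_S` by `9 ^ k` times the square of its second
moment, so that `E |f_S|` is at least `‖f_S‖₂ / (3 · 3 ^ k)` (`le_sum_abs_signPoly`). By Parseval
`‖f_S‖₂²` is the sum of the squared minors, and it remains to bound this below by a constant times
`n ^ (-k)` uniformly in `S` (`le_sum_pairMinor_sq`). This is an integrality argument: `k! (8 n) ^ k`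
times the sum is an integer, because cosine sums over the odd frequencies are integer multiples of
`n`. It is positive, because the minor on the `k` lowest frequencies is nonzero by a Vandermonde
argument. Hence it is at least `1`. -/

namespace FermionicJM

/-! ### Matrix entries and Clifford relations of the Majorana operators -/

section Majorana

variable {n : ℕ}

/-- The sign picked up by the Majorana operator `i` from an occupied mode `x`. -/
noncomputable def modeSign (i : Fin (2 * n)) (x : Fin n) : ℂ :=
  if x < mode i ∨ (x = mode i ∧ i.val % 2 = 1) then -1 else 1

/-- The overall phase of the Majorana operator `i`. -/
noncomputable def majoranaPhase (i : Fin (2 * n)) : ℂ := if i.val % 2 = 0 then 1 else Complex.I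

lemma prod_modeSign (i : Fin (2 * n)) (T : Finset (Fin n)) :
    ∏ x ∈ T, modeSign i x = (-1) ^ (T.filter (· < mode i)).card *
      (if mode i ∈ T ∧ i.val % 2 = 1 then -1 else 1) := by
  have h : ∀ x, modeSign i x = (if x < mode i then -1 else 1) *
      (if x = mode i then (if i.val % 2 = 1 then -1 else 1) else 1) := by
    intro x
    unfold modeSign
    rcases lt_trichotomy x (mode i) with h | h | h
    · simp [h, h.ne]
    · simp [h]
    · simp [h.not_gt, h.ne']
  simp only [h, Finset.prod_mul_distrib]
  congr 1
  · rw [Finset.prod_ite]; simp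
  · rw [Finset.prod_ite_eq']
    by_cases h1 : mode i ∈ T <;> simp [h1]

lemma prod_modeSign_symmDiff (i : Fin (2 * n)) (T : Finset (Fin n)) (b : Fin n) :
    ∏ x ∈ symmDiff T {b}, modeSign i x = (∏ x ∈ T, modeSign i x) * modeSign i b := by
  have hsq : modeSign i b * modeSign i b = 1 := by unfold modeSign; split_ifs <;> norm_num
  by_cases hb : b ∈ T
  · have : symmDiff T {b} = T.erase b := by
      ext x; simp only [Finset.mem_symmDiff, Finset.mem_singleton, Finset.mem_erase]; grind
    rw [this, ← Finset.mul_prod_erase T _ hb]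
    linear_combination (-∏ x ∈ T.erase b, modeSign i x) * hsq
  · have : symmDiff T {b} = insert b T := by
      ext x; simp only [Finset.mem_symmDiff, Finset.mem_singleton, Finset.mem_insert]; grind
    rw [this, Finset.prod_insert hb, mul_comm]

/-- A Majorana operator toggles its mode, up to a phase. Writing the sign as a product over the
occupied modes makes it multiplicative under toggling, so products of two Majorana operators can be
read off entrywise. -/
lemma majorana_apply (i : Fin (2 * n)) (T T' : Finset (Fin n)) :
    majorana i T T' = if T = symmDiff T' {mode i} then
      majoranaPhase i * ∏ x ∈ T', modeSign i x else 0 := by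
  rw [prod_modeSign]
  have hstar : star (annihilation (mode i) T' T) = annihilation (mode i) T' T := by
    simp only [annihilation, Matrix.of_apply]; split_ifs <;> simp
  by_cases hm : mode i ∈ T'
  · have hsd : symmDiff T' {mode i} = T'.erase (mode i) := by
      ext x; simp only [Finset.mem_symmDiff, Finset.mem_singleton, Finset.mem_erase]; grind
    have h1 : annihilation (mode i) T' T = 0 := by
      simp only [annihilation, Matrix.of_apply]
      rw [if_neg]
      rintro ⟨-, rfl⟩
      simp at hm
    have h2 : annihilation (mode i) T T' = if T = T'.erase (mode i) then
        (-1) ^ (T'.filter (· < mode i)).card else 0 := by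
      simp [annihilation, hm]
    rw [hsd]
    unfold majorana majoranaPhase
    by_cases hp : i.val % 2 = 0
    · simp only [hp, if_true, Matrix.add_apply, Matrix.conjTranspose_apply, h1, h2]
      split_ifs <;> simp_all
    · have hp1 : i.val % 2 = 1 := by omega
      simp only [hp, if_false, Matrix.smul_apply, Matrix.sub_apply, Matrix.conjTranspose_apply,
        h1, h2]
      split_ifs <;> simp_all
  · have hsd : symmDiff T' {mode i} = insert (mode i) T' := by
      ext x; simp only [Finset.mem_symmDiff, Finset.mem_singleton, Finset.mem_insert]; grind
    have h1 : annihilation (mode i) T T' = 0 := by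
      simp [annihilation, hm]
    have h2 : annihilation (mode i) T' T = if T = insert (mode i) T' then
        (-1) ^ (T'.filter (· < mode i)).card else 0 := by
      simp only [annihilation, Matrix.of_apply]
      by_cases hT : T = insert (mode i) T'
      · subst hT
        simp [hm, Finset.filter_insert]
      · rw [if_neg hT, if_neg]
        rintro ⟨h, rfl⟩
        exact hT (Finset.insert_erase h).symm
    rw [hsd]
    unfold majorana majoranaPhase
    by_cases hp : i.val % 2 = 0
    · simp only [hp, if_true, Matrix.add_apply, Matrix.conjTranspose_apply, h1, h2]
      split_ifs <;> simp_all
    · simp only [hp, if_false, Matrix.smul_apply, Matrix.sub_apply, Matrix.conjTranspose_apply,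
        h1, h2]
      split_ifs <;> simp_all

lemma majorana_mul_apply (i j : Fin (2 * n)) (T T' : Finset (Fin n)) :
    (majorana i * majorana j) T T' =
      if T = symmDiff (symmDiff T' {mode j}) {mode i} then
        majoranaPhase i * majoranaPhase j * modeSign i (mode j) *
          ((∏ x ∈ T', modeSign i x) * ∏ x ∈ T', modeSign j x) else 0 := by
  rw [Matrix.mul_apply, Finset.sum_eq_single (symmDiff T' {mode j})]
  · rw [majorana_apply, majorana_apply, if_pos rfl, prod_modeSign_symmDiff]
    split_ifs <;> ring
  · intro U _ hU
    rw [majorana_apply j, if_neg hU, mul_zero]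
  · simp

lemma majorana_mul_self (i : Fin (2 * n)) : majorana i * majorana i = 1 := by
  ext T T'
  have hsq : (∏ x ∈ T', modeSign i x) * ∏ x ∈ T', modeSign i x = 1 := by
    rw [← Finset.prod_mul_distrib]
    refine Finset.prod_eq_one fun x _ => ?_
    unfold modeSign; split_ifs <;> norm_num
  have hp : majoranaPhase i * majoranaPhase i * modeSign i (mode i) = 1 := by
    unfold majoranaPhase modeSign
    rcases Nat.mod_two_eq_zero_or_one i.val with h | h <;> simp [h]
  rw [majorana_mul_apply, hsq, hp, symmDiff_assoc, symmDiff_self, symmDiff_bot, mul_one,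
    Matrix.one_apply]

/-- Exchanging the factors changes only which of `modeSign i (mode j)` and `modeSign j (mode i)`
occurs. Exactly one of them is `-1`, namely the one whose Majorana index is the larger. -/
lemma majorana_anticomm {i j : Fin (2 * n)} (hij : i ≠ j) :
    majorana i * majorana j = -(majorana j * majorana i) := by
  ext T T'
  have hs : modeSign i (mode j) = -modeSign j (mode i) := by
    have hne : i.val ≠ j.val := fun h => hij (Fin.ext h)
    unfold modeSign mode
    simp only [Fin.lt_def, Fin.ext_iff]
    split_ifs <;> first | (exfalso; omega) | norm_num
  rw [Matrix.neg_apply, majorana_mul_apply, majorana_mul_apply, hs,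
    symmDiff_assoc T', symmDiff_assoc T', symmDiff_comm {mode j}]
  split_ifs <;> ring

lemma majorana_conjTranspose (i : Fin (2 * n)) : (majorana i)ᴴ = majorana i := by
  unfold majorana
  split_ifs
  · simp [add_comm]
  · simp only [Matrix.conjTranspose_smul, Matrix.conjTranspose_sub,
      Matrix.conjTranspose_conjTranspose, Complex.star_def, Complex.conj_I, neg_smul,
      ← smul_neg, neg_sub]

end Majorana

/-! ### Reordering products of anticommuting elements -/

section Anticommuting

variable {A : Type*} [Ring A]

lemma ofFn_prod_comp_swap : ∀ {m : ℕ} (i : Fin m) (x : Fin (m + 1) → A),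
    x i.castSucc * x i.succ = -(x i.succ * x i.castSucc) →
    (List.ofFn (x ∘ Equiv.swap i.castSucc i.succ)).prod = -(List.ofFn x).prod
  | 0, i, _, _ => i.elim0
  | m + 1, i, x, h => by
    refine Fin.cases ?_ (fun j => ?_) i (motive := fun i =>
      x i.castSucc * x i.succ = -(x i.succ * x i.castSucc) →
      (List.ofFn (x ∘ Equiv.swap i.castSucc i.succ)).prod = -(List.ofFn x).prod) h
    · intro h
      have hrest : ∀ j : Fin m, (Equiv.swap (0 : Fin (m + 2)) 1) j.succ.succ = j.succ.succ :=
        fun j => Equiv.swap_apply_of_ne_of_ne (by simp [Fin.ext_iff]) (by simp [Fin.ext_iff])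
      simp only [Fin.castSucc_zero, Fin.succ_zero_eq_one] at h ⊢
      simp only [List.ofFn_succ, List.prod_cons, Function.comp, hrest, Fin.succ_zero_eq_one,
        Equiv.swap_apply_left, Equiv.swap_apply_right, ← mul_assoc, h, neg_mul, neg_neg]
    · intro h
      have h0 : (Equiv.swap j.succ.castSucc j.succ.succ) (0 : Fin (m + 2)) = 0 :=
        Equiv.swap_apply_of_ne_of_ne (by simp [Fin.ext_iff]) (by simp [Fin.ext_iff])
      have hs : ∀ l : Fin (m + 1), (Equiv.swap j.succ.castSucc j.succ.succ) l.succ =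
          ((Equiv.swap j.castSucc j.succ) l).succ := by
        intro l
        rw [← Fin.succ_castSucc]
        exact (Fin.succ_injective _).swap_apply _ _ _
      have ih := ofFn_prod_comp_swap j (fun l => x l.succ) h
      rw [List.ofFn_succ, List.ofFn_succ (f := x), List.prod_cons, List.prod_cons,
        Function.comp, h0, ← mul_neg, ← ih]
      simp only [Function.comp, hs]
      rfl

/-- A product of pairwise anticommuting elements is alternating in the order of the factors. -/
lemma ofFn_prod_comp_perm {m : ℕ} (π : Equiv.Perm (Fin m)) (x : Fin m → A)
    (hx : ∀ i j, i ≠ j → x i * x j = -(x j * x i)) :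
    (List.ofFn (x ∘ π)).prod = ((Equiv.Perm.sign π : ℤˣ) : ℤ) • (List.ofFn x).prod := by
  cases m with
  | zero => simp [Subsingleton.elim π 1]
  | succ m =>
    have hmem : π ∈ Submonoid.closure
        (Set.range fun i : Fin m => Equiv.swap i.castSucc i.succ) := by
      rw [Equiv.Perm.mclosure_swap_castSucc_succ]; trivial
    revert x
    induction hmem using Submonoid.closure_induction with
    | mem π h =>
      obtain ⟨i, rfl⟩ := h
      intro x hx
      rw [ofFn_prod_comp_swap i x (hx _ _ (Fin.castSucc_lt_succ).ne),
        Equiv.Perm.sign_swap (Fin.castSucc_lt_succ).ne]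
      simp
    | one => intro x _; simp
    | mul π τ _ _ hπ hτ =>
      intro x hx
      have := hτ (x ∘ π) fun i j hij => hx _ _ (π.injective.ne hij)
      rw [Equiv.Perm.coe_mul, ← Function.comp_assoc, this, hπ x hx, smul_smul, map_mul,
        Units.val_mul, mul_comm]

end Anticommuting

/-! ### Rotated Majorana operators and their minor expansion -/

section Rotated

variable {n : ℕ}

/-- The rotated Majorana operator `∑ s, O r s γ_s`. -/
noncomputable def rotatedMajorana (O : Matrix (Fin (2 * n)) (Fin (2 * n)) ℝ) (r : Fin (2 * n)) :
    FockOp n :=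
  ∑ s, (O r s : ℂ) • majorana s

/-- Symmetrising kills all terms off the diagonal, so the relations depend on `O` only through the
Gram matrix of its rows. For orthogonal `O` they are again the Clifford relations. -/
lemma rotatedMajorana_mul_add (O : Matrix (Fin (2 * n)) (Fin (2 * n)) ℝ) (r t : Fin (2 * n)) :
    rotatedMajorana O r * rotatedMajorana O t + rotatedMajorana O t * rotatedMajorana O r =
      (2 * ((O * Oᵀ) r t : ℂ)) • 1 := by
  have h : ∀ a b : Fin (2 * n), majorana a * majorana b + majorana b * majorana a =
      (if a = b then (2 : ℂ) else 0) • (1 : FockOp n) := by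
    intro a b
    split_ifs with hab
    · subst hab; rw [majorana_mul_self, two_smul]
    · rw [majorana_anticomm hab]; simp
  have e1 : rotatedMajorana O r * rotatedMajorana O t =
      ∑ a, ∑ b, ((O r a : ℂ) * (O t b : ℂ)) • (majorana a * majorana b) := by
    simp only [rotatedMajorana, Finset.sum_mul_sum, smul_mul_smul_comm]
  have e2 : rotatedMajorana O t * rotatedMajorana O r =
      ∑ a, ∑ b, ((O r a : ℂ) * (O t b : ℂ)) • (majorana b * majorana a) := by
    simp only [rotatedMajorana, Finset.sum_mul_sum, smul_mul_smul_comm]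
    rw [Finset.sum_comm]
    simp only [mul_comm (O t _ : ℂ)]
  rw [e1, e2]
  simp only [← Finset.sum_add_distrib, ← smul_add, h, smul_smul, ← Finset.sum_smul]
  congr 1
  simp [Matrix.mul_apply, Finset.mul_sum, mul_comm]

variable {O : Matrix (Fin (2 * n)) (Fin (2 * n)) ℝ}

lemma rotatedMajorana_mul_self (hO : O * Oᵀ = 1) (r : Fin (2 * n)) :
    rotatedMajorana O r * rotatedMajorana O r = 1 := by
  have h := rotatedMajorana_mul_add O r r
  rw [hO, Matrix.one_apply_eq, ← two_smul ℂ] at h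
  simpa using congrArg (fun x => (2 : ℂ)⁻¹ • x) h

lemma rotatedMajorana_anticomm (hO : O * Oᵀ = 1) {r t : Fin (2 * n)} (h : r ≠ t) :
    rotatedMajorana O r * rotatedMajorana O t = -(rotatedMajorana O t * rotatedMajorana O r) := by
  have h' := rotatedMajorana_mul_add O r t
  rw [hO, Matrix.one_apply_ne h] at h'
  exact eq_neg_of_add_eq_zero_left (by simpa using h')

lemma rotatedMajorana_conjTranspose (O : Matrix (Fin (2 * n)) (Fin (2 * n)) ℝ) (r : Fin (2 * n)) :
    (rotatedMajorana O r)ᴴ = rotatedMajorana O r := by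
  simp [rotatedMajorana, Matrix.conjTranspose_sum, Matrix.conjTranspose_smul,
    majorana_conjTranspose]

lemma ofFn_rotatedMajorana_prod {m : ℕ} (O : Matrix (Fin (2 * n)) (Fin (2 * n)) ℝ)
    (r : Fin m → Fin (2 * n)) :
    (List.ofFn fun i => rotatedMajorana O (r i)).prod =
      ∑ s : Fin m → Fin (2 * n), (∏ i, (O (r i) (s i) : ℂ)) •
        (List.ofFn fun i => majorana (s i)).prod := by
  have h := (MultilinearMap.mkPiAlgebraFin ℂ m (FockOp n)).map_sum
    (fun i s => (O (r i) s : ℂ) • majorana s)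
  simp only [MultilinearMap.map_smul_univ, MultilinearMap.mkPiAlgebraFin_apply] at h
  exact h

/-- A sum over all injective tuples, organised by the image of the tuple. -/
lemma sum_eq_sum_subset_perm {α : Type*} [Fintype α] [LinearOrder α] {m : ℕ}
    {M : Type*} [AddCommMonoid M] (F : (Fin m → α) → M) (hF : ∀ s, ¬ Function.Injective s → F s = 0) :
    ∑ s, F s = ∑ S : {S : Finset α // S.card = m},
      ∑ π : Equiv.Perm (Fin m), F (S.1.orderEmbOfFin S.2 ∘ π) := by
  have himg : ∀ (S : {S : Finset α // S.card = m}) (π : Equiv.Perm (Fin m)),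
      Finset.univ.image (S.1.orderEmbOfFin S.2 ∘ π) = S.1 := by
    intro S π
    rw [← Finset.image_image, Finset.image_univ_equiv, Finset.image_orderEmbOfFin_univ]
  rw [← Fintype.sum_prod_type', ← Finset.sum_filter_of_ne (p := Function.Injective)
    (fun s _ h => by by_contra h'; exact h (hF s h'))]
  symm
  refine Finset.sum_nbij (fun p : {S : Finset α // S.card = m} × Equiv.Perm (Fin m) =>
    (p.1.1.orderEmbOfFin p.1.2 ∘ p.2)) ?_ ?_ ?_ (fun _ _ => rfl)
  · rintro ⟨S, π⟩ -
    simpa using (S.1.orderEmbOfFin S.2).injective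
  · rintro ⟨S, π⟩ - ⟨S', π'⟩ - h
    have hS : S = S' := Subtype.ext (by rw [← himg S π, ← himg S' π']; exact congrArg (fun s => Finset.univ.image s) h)
    subst hS
    have hπ : π = π' := Equiv.ext fun i => (S.1.orderEmbOfFin S.2).injective (congrFun h i)
    rw [hπ]
  · intro s hs
    have hs' : Function.Injective s := by simpa using hs
    have hc : (Finset.univ.image s).card = m := by
      rw [Finset.card_image_of_injective _ hs']; simp
    let g : Fin m → Fin m := fun i =>
      ((Finset.univ.image s).orderIsoOfFin hc).symm ⟨s i, by simp⟩
    have hg : Function.Injective g := by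
      intro i j hij
      have := ((Finset.univ.image s).orderIsoOfFin hc).symm.injective hij
      exact hs' (by simpa using this)
    refine ⟨(⟨_, hc⟩, Equiv.ofBijective g (Finite.injective_iff_bijective.1 hg)), by simp, ?_⟩
    funext i
    simp [g, Finset.orderEmbOfFin]

/-- Averaging over all orders of the anticommuting factors turns the coefficient of each tuple `s`
into a determinant. Tuples with a repetition drop out. The `m!` orderings of a set `S` contribute
equally, because the determinant and the Majorana product pick up the same sign. The factor `m!`
then cancels. -/
lemma ofFn_rotatedMajorana_prod_eq_sum_det {m : ℕ} (hO : O * Oᵀ = 1) {r : Fin m → Fin (2 * n)}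
    (hr : Function.Injective r) :
    (List.ofFn fun i => rotatedMajorana O (r i)).prod =
      ∑ S : DegSet n m, ((O.submatrix r (S.1.orderEmbOfFin S.2)).det : ℂ) •
        (List.ofFn fun i => majorana (S.1.orderEmbOfFin S.2 i)).prod := by
  set w : (Fin m → Fin (2 * n)) → FockOp n := fun s => (List.ofFn fun i => majorana (s i)).prod
    with hw
  have hsq : ∀ π : Equiv.Perm (Fin m),
      ((Equiv.Perm.sign π : ℤ) : ℂ) * ((Equiv.Perm.sign π : ℤ) : ℂ) = 1 := by
    intro π
    rcases Int.units_eq_one_or (Equiv.Perm.sign π) with h | h <;> simp [h]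
  have h1 : ∀ π : Equiv.Perm (Fin m), (List.ofFn fun i => rotatedMajorana O (r i)).prod =
      ∑ s, (((Equiv.Perm.sign π : ℤ) : ℂ) * ∏ i, (O (r (π i)) (s i) : ℂ)) • w s := by
    intro π
    have h := ofFn_prod_comp_perm π (fun i => rotatedMajorana O (r i))
      fun i j hij => rotatedMajorana_anticomm hO (hr.ne hij)
    have h2 := ofFn_rotatedMajorana_prod O (r ∘ π)
    simp only [Function.comp_def] at h h2
    rw [h, ← Int.cast_smul_eq_zsmul ℂ] at h2
    have h3 := congrArg (fun x => ((Equiv.Perm.sign π : ℤ) : ℂ) • x) h2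
    simp only [smul_smul, hsq, one_smul, Finset.smul_sum] at h3
    exact h3
  have h2 : (m.factorial : ℂ) • (List.ofFn fun i => rotatedMajorana O (r i)).prod =
      ∑ s : Fin m → Fin (2 * n), ((O.submatrix r s).det : ℂ) • w s := by
    have : ∑ π : Equiv.Perm (Fin m), (List.ofFn fun i => rotatedMajorana O (r i)).prod =
      ∑ π : Equiv.Perm (Fin m), ∑ s,
        (((Equiv.Perm.sign π : ℤ) : ℂ) * ∏ i, (O (r (π i)) (s i) : ℂ)) • w s :=
      Finset.sum_congr rfl fun π _ => h1 π
    rw [Finset.sum_const, Finset.card_univ, Fintype.card_perm, Fintype.card_fin,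
      ← Nat.cast_smul_eq_nsmul ℂ, Finset.sum_comm] at this
    rw [this]
    refine Finset.sum_congr rfl fun s _ => ?_
    rw [← Finset.sum_smul, Matrix.det_apply']
    push_cast
    rfl
  rw [sum_eq_sum_subset_perm] at h2
  · have h3 : ∀ (S : DegSet n m) (π : Equiv.Perm (Fin m)),
        ((O.submatrix r (S.1.orderEmbOfFin S.2 ∘ π)).det : ℂ) • w (S.1.orderEmbOfFin S.2 ∘ π) =
        ((O.submatrix r (S.1.orderEmbOfFin S.2)).det : ℂ) • w (S.1.orderEmbOfFin S.2) := by
      intro S π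
      have hd : (O.submatrix r (S.1.orderEmbOfFin S.2 ∘ π)).det =
          (Equiv.Perm.sign π : ℤ) * (O.submatrix r (S.1.orderEmbOfFin S.2)).det := by
        rw [← Matrix.det_permute' π, Matrix.submatrix_submatrix]; rfl
      have hp := ofFn_prod_comp_perm π (fun i => majorana (S.1.orderEmbOfFin S.2 i))
        fun i j hij => majorana_anticomm ((S.1.orderEmbOfFin S.2).injective.ne hij)
      have hp' : w (S.1.orderEmbOfFin S.2 ∘ π) =
          ((Equiv.Perm.sign π : ℤ) : ℂ) • w (S.1.orderEmbOfFin S.2) := by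
        rw [Int.cast_smul_eq_zsmul]; exact hp
      rw [hd, hp', smul_smul]
      congr 1
      push_cast
      linear_combination ((O.submatrix r (S.1.orderEmbOfFin S.2)).det : ℂ) * hsq π
    simp only [h3, Finset.sum_const, Finset.card_univ, Fintype.card_perm, Fintype.card_fin,
      ← Finset.smul_sum, ← Nat.cast_smul_eq_nsmul ℂ] at h2
    exact smul_right_injective _ (Nat.cast_ne_zero.2 m.factorial_ne_zero) h2
  · intro s hs
    obtain ⟨i, j, hij, hne⟩ := by simpa [Function.Injective] using hs
    rw [Matrix.det_zero_of_column_eq hne fun a => by simp [hij]]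
    simp

lemma monomial_eq_ofFn {m : ℕ} (S : Finset (Fin (2 * n))) (hS : S.card = m) :
    monomial S = Complex.I ^ (m.choose 2) •
      (List.ofFn fun i => majorana (S.orderEmbOfFin hS i)).prod := by
  subst hS
  unfold monomial
  congr 2
  apply List.ext_getElem
  · simp
  · intro i h1 h2
    simp [Finset.orderEmbOfFin_apply]

lemma rotated_eq_ofFn {m : ℕ} (hO : O * Oᵀ = 1) (R : DegSet n m) :
    rotated O R = Complex.I ^ (m.choose 2) •
      (List.ofFn fun i => rotatedMajorana O (R.1.orderEmbOfFin R.2 i)).prod := by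
  rw [ofFn_rotatedMajorana_prod_eq_sum_det hO (R.1.orderEmbOfFin R.2).injective, Finset.smul_sum]
  refine Finset.sum_congr rfl fun S _ => ?_
  rw [monomial_eq_ofFn S.1 S.2, smul_comm]
  rfl

/-- The index of the first (`b = 0`) or second (`b = 1`) Majorana operator of mode `j`. -/
def pairIndex (j : Fin n) (b : Fin 2) : Fin (2 * n) := ⟨2 * j.val + b.val, by omega⟩

lemma pairIndex_inj {i j : Fin n} {a b : Fin 2} (h : pairIndex i a = pairIndex j b) :
    i = j ∧ a = b := by
  simp only [pairIndex, Fin.mk.injEq] at h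
  constructor <;> ext <;> omega

lemma orderEmbOfFin_modePair (j : Fin n) (b : Fin 2) :
    (modePair j).1.orderEmbOfFin (modePair j).2 b = pairIndex j b := by
  have hmono : StrictMono (pairIndex j) := by
    intro a b hab
    simp only [pairIndex, Fin.lt_def] at hab ⊢
    omega
  have := Finset.orderEmbOfFin_unique (modePair j).2 (f := pairIndex j) (fun b => by
    fin_cases b <;> simp [modePair, pairIndex]) hmono
  rw [← this]

lemma rotated_modePair (hO : O * Oᵀ = 1) (j : Fin n) :
    rotated O (modePair j) =
      Complex.I • (rotatedMajorana O (pairIndex j 0) * rotatedMajorana O (pairIndex j 1)) := by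
  rw [rotated_eq_ofFn hO]
  simp only [orderEmbOfFin_modePair]
  simp [List.ofFn_succ]

/-- The Majorana indices of a tuple of modes, listed mode by mode. -/
def pairRow {k : ℕ} (j : Fin k → Fin n) (i : Fin (k * 2)) : Fin (2 * n) :=
  pairIndex (j (finProdFinEquiv.symm i).1) (finProdFinEquiv.symm i).2

lemma pairRow_injective {k : ℕ} {j : Fin k → Fin n} (hj : Function.Injective j) :
    Function.Injective (pairRow j) := by
  intro a b h
  obtain ⟨h1, h2⟩ := pairIndex_inj h
  exact finProdFinEquiv.symm.injective (Prod.ext (hj h1) h2)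

/-- The phase of a monomial of degree `2 k` has to match the phase `i ^ k` of a product of `k` pair
observables. The two exponents differ by `2 k (k - 1)`, a multiple of `4`. -/
lemma I_pow_choose (k : ℕ) : Complex.I ^ ((k * 2).choose 2) = Complex.I ^ k := by
  have h : (k * 2).choose 2 = k + 2 * (k * (k - 1)) := by
    rw [Nat.choose_two_right]
    cases k with
    | zero => simp
    | succ k =>
      apply Nat.div_eq_of_eq_mul_left (by norm_num)
      simp only [Nat.add_sub_cancel]
      have : (k + 1) * 2 - 1 = 2 * k + 1 := by omega
      rw [this]; ring
  rw [h, pow_add, pow_mul, Complex.I_sq, (Nat.even_mul_pred_self k).neg_one_pow, mul_one]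

lemma ofFn_rotated_modePair_prod (hO : O * Oᵀ = 1) {k : ℕ} {j : Fin k → Fin n}
    (hj : Function.Injective j) :
    (List.ofFn fun i => rotated O (modePair (j i))).prod =
      ∑ S : DegSet n (k * 2),
        ((O.submatrix (pairRow j) (S.1.orderEmbOfFin S.2)).det : ℂ) • monomial S.1 := by
  have h1 : (List.ofFn fun i => rotated O (modePair (j i))).prod =
      Complex.I ^ k • (List.ofFn fun i => rotatedMajorana O (pairRow j i)).prod := by
    have h := MultilinearMap.map_smul_univ (MultilinearMap.mkPiAlgebraFin ℂ k (FockOp n))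
      (fun _ => Complex.I) (fun i => rotatedMajorana O (pairIndex (j i) 0) *
        rotatedMajorana O (pairIndex (j i) 1))
    simp only [MultilinearMap.mkPiAlgebraFin_apply, Finset.prod_const, Finset.card_univ,
      Fintype.card_fin] at h
    simp only [rotated_modePair hO]
    rw [h, List.ofFn_mul, List.prod_flatten, List.map_ofFn]
    congr 3
    funext i
    have hp : ∀ (b : Fin 2) (h : i.val * 2 + b.val < k * 2),
        pairRow j ⟨i.val * 2 + b.val, h⟩ = pairIndex (j i) b := by
      intro b h
      have : (⟨i.val * 2 + b.val, h⟩ : Fin (k * 2)) = finProdFinEquiv (i, b) := by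
        ext; simp [finProdFinEquiv]; ring
      rw [pairRow, this, Equiv.symm_apply_apply]
    simp only [Function.comp, hp]
    simp [List.ofFn_succ]
  rw [h1, ofFn_rotatedMajorana_prod_eq_sum_det hO (pairRow_injective hj), Finset.smul_sum]
  refine Finset.sum_congr rfl fun S _ => ?_
  rw [monomial_eq_ofFn S.1 S.2, smul_comm, I_pow_choose]

end Rotated

/-! ### Conjugation by Majorana monomials and the characters it produces -/

section Twirl

variable {n : ℕ}

lemma prod_map_sort {M : Type*} [CommMonoid M] (S : Finset (Fin (2 * n))) (f : Fin (2 * n) → M) :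
    ((S.sort (· ≤ ·)).map f).prod = ∏ i ∈ S, f i := by
  rw [← List.prod_toFinset f (Finset.sort_nodup S (· ≤ ·)), Finset.sort_toFinset]

lemma list_majorana_prod_conjTranspose_mul (l : List (Fin (2 * n))) :
    ((l.map majorana).prod)ᴴ * (l.map majorana).prod = 1 := by
  induction l with
  | nil => simp
  | cons a l ih =>
    rw [List.map_cons, List.prod_cons, Matrix.conjTranspose_mul, majorana_conjTranspose,
      mul_assoc, ← mul_assoc (majorana a), majorana_mul_self, one_mul, ih]

lemma monomial_conjTranspose_mul (X : Finset (Fin (2 * n))) : (monomial X)ᴴ * monomial X = 1 := by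
  have h : star (Complex.I ^ X.card.choose 2) * Complex.I ^ X.card.choose 2 = 1 := by
    rw [star_pow, ← mul_pow]; simp
  unfold monomial
  rw [Matrix.conjTranspose_smul, smul_mul_smul_comm, h, one_smul,
    list_majorana_prod_conjTranspose_mul]

lemma monomial_mul_conjTranspose (X : Finset (Fin (2 * n))) : monomial X * (monomial X)ᴴ = 1 :=
  mul_eq_one_comm.1 (monomial_conjTranspose_mul X)

lemma list_majorana_prod_mul_majorana (l : List (Fin (2 * n))) (x : Fin (2 * n)) :
    (l.map majorana).prod * majorana x =
      (l.map fun s => if s = x then (1 : ℂ) else -1).prod • (majorana x * (l.map majorana).prod) := by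
  induction l with
  | nil => simp
  | cons a l ih =>
    rw [List.map_cons, List.prod_cons, mul_assoc, ih, mul_smul_comm, List.map_cons, List.prod_cons,
      ← mul_assoc, ← mul_assoc]
    by_cases h : a = x
    · simp [h]
    · rw [majorana_anticomm h]; simp [h]

/-- The character `X ↦ (-1) ^ |S ∩ X|`. -/
noncomputable def parity (S X : Finset (Fin (2 * n))) : ℝ := ∏ x ∈ X, if x ∈ S then -1 else 1

lemma parity_eq (S X : Finset (Fin (2 * n))) : parity S X = 1 ∨ parity S X = -1 := by
  unfold parity
  induction X using Finset.induction_on with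
  | empty => simp
  | insert a X ha ih =>
    rw [Finset.prod_insert ha]
    split_ifs <;> rcases ih with h | h <;> simp [h]

/-- Moving `γ_x` past `γ_S` costs `(-1) ^ |S|` if `x ∉ S` and one sign less if `x ∈ S`. For even
`|S|` only the indices `x ∈ S ∩ X` contribute a sign. -/
lemma monomial_mul_monomial (S X : Finset (Fin (2 * n))) (hS : Even S.card) :
    monomial S * monomial X = (parity S X : ℂ) • (monomial X * monomial S) := by
  have hx : ∀ x, ((S.sort (· ≤ ·)).map fun s => if s = x then (1 : ℂ) else -1).prod =
      if x ∈ S then -1 else 1 := by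
    intro x
    have h : ∏ s ∈ S, (if s = x then (1 : ℂ) else -1) =
        (∏ s ∈ S, (-1)) * ∏ s ∈ S, (if s = x then (-1 : ℂ) else 1) := by
      rw [← Finset.prod_mul_distrib]
      refine Finset.prod_congr rfl fun s _ => ?_
      split_ifs <;> norm_num
    rw [prod_map_sort, h, Finset.prod_const, hS.neg_one_pow, one_mul, Finset.prod_ite_eq']
  have key : ∀ l : List (Fin (2 * n)),
      ((S.sort (· ≤ ·)).map majorana).prod * (l.map majorana).prod =
      (l.map fun x => if x ∈ S then (-1 : ℂ) else 1).prod •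
        ((l.map majorana).prod * ((S.sort (· ≤ ·)).map majorana).prod) := by
    intro l
    induction l with
    | nil => simp
    | cons a l ih =>
      rw [List.map_cons, List.prod_cons, ← mul_assoc, list_majorana_prod_mul_majorana, hx,
        smul_mul_assoc, mul_assoc, ih, mul_smul_comm, smul_smul, List.map_cons, List.prod_cons,
        mul_assoc]
  unfold monomial
  rw [smul_mul_smul_comm, smul_mul_smul_comm, key, smul_smul, smul_smul, prod_map_sort]
  congr 1
  unfold parity
  push_cast [apply_ite]
  ring

lemma monomial_conj (S X : Finset (Fin (2 * n))) (hS : Even S.card) :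
    (monomial X)ᴴ * monomial S * monomial X = (parity S X : ℂ) • monomial S := by
  rw [mul_assoc, monomial_mul_monomial S X hS, mul_smul_comm, ← mul_assoc,
    monomial_conjTranspose_mul, one_mul]

/-- The sum over subsets `X` factorises over indices. An index in exactly one of `S` and `T` gives
the factor `1 - 1`, any other the factor `2`. -/
lemma sum_parity_mul_parity (S T : Finset (Fin (2 * n))) :
    ∑ X, parity S X * parity T X = if S = T then (2 : ℝ) ^ (2 * n) else 0 := by
  have h : ∑ X, parity S X * parity T X = ∏ x : Fin (2 * n),
      (1 + (if x ∈ S then (-1 : ℝ) else 1) * if x ∈ T then -1 else 1) := by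
    rw [Finset.prod_one_add, Finset.powerset_univ]
    simp only [parity, Finset.prod_mul_distrib]
  rw [h]
  split_ifs with hST
  · subst hST
    rw [Finset.prod_congr rfl (g := fun _ => (2 : ℝ))]
    · simp
    · intro x _; split_ifs <;> norm_num
  · obtain ⟨x, hx⟩ : ∃ x, ¬ (x ∈ S ↔ x ∈ T) := by
      by_contra! hc
      exact hST (Finset.ext hc)
    refine Finset.prod_eq_zero (Finset.mem_univ x) ?_
    by_cases h1 : x ∈ S <;> by_cases h2 : x ∈ T <;> simp_all

/-- The twirl with the character of `S` projects onto the multiples of `γ_S`. -/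
lemma sum_parity_smul_conj (S T : Finset (Fin (2 * n))) (hT : Even T.card) :
    ∑ X, (parity S X : ℂ) • ((monomial X)ᴴ * monomial T * monomial X) =
      if S = T then (2 : ℂ) ^ (2 * n) • monomial S else 0 := by
  simp only [monomial_conj _ _ hT, smul_smul, ← Finset.sum_smul]
  have h := congrArg (fun x : ℝ => (x : ℂ)) (sum_parity_mul_parity S T)
  push_cast at h
  rw [h]
  split_ifs with hST
  · subst hST; simp
  · simp

end Twirl

/-! ### The parent measurement and its twirled effects -/

section Parent

variable {n : ℕ} {O : Matrix (Fin (2 * n)) (Fin (2 * n)) ℝ}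

lemma rotated_modePair_mul_self (hO : O * Oᵀ = 1) (j : Fin n) :
    rotated O (modePair j) * rotated O (modePair j) = 1 := by
  have hne : pairIndex j 1 ≠ pairIndex j 0 := fun h => by simpa using (pairIndex_inj h).2
  rw [rotated_modePair hO, smul_mul_smul_comm, Complex.I_mul_I, mul_assoc,
    ← mul_assoc (rotatedMajorana O (pairIndex j 1)), rotatedMajorana_anticomm hO hne,
    neg_mul, mul_assoc (rotatedMajorana O (pairIndex j 0)) (rotatedMajorana O (pairIndex j 1)),
    rotatedMajorana_mul_self hO, mul_one, mul_neg, rotatedMajorana_mul_self hO]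
  simp

lemma rotated_modePair_conjTranspose (hO : O * Oᵀ = 1) (j : Fin n) :
    (rotated O (modePair j))ᴴ = rotated O (modePair j) := by
  have hne : pairIndex j 1 ≠ pairIndex j 0 := fun h => by simpa using (pairIndex_inj h).2
  rw [rotated_modePair hO, Matrix.conjTranspose_smul, Matrix.conjTranspose_mul,
    rotatedMajorana_conjTranspose, rotatedMajorana_conjTranspose, rotatedMajorana_anticomm hO hne]
  simp

lemma rotated_modePair_commute (hO : O * Oᵀ = 1) (i j : Fin n) :
    Commute (rotated O (modePair i)) (rotated O (modePair j)) := by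
  rcases eq_or_ne i j with rfl | hij
  · exact Commute.refl _
  have hne : ∀ a b, pairIndex i a ≠ pairIndex j b := fun a b h => hij (pairIndex_inj h).1
  have h : ∀ a b, rotatedMajorana O (pairIndex i a) * rotatedMajorana O (pairIndex j b) =
      -(rotatedMajorana O (pairIndex j b) * rotatedMajorana O (pairIndex i a)) :=
    fun a b => rotatedMajorana_anticomm hO (hne a b)
  rw [rotated_modePair hO, rotated_modePair hO]
  refine Commute.smul_left (Commute.smul_right ?_ _) _
  have h1 : ∀ b, Commute (rotatedMajorana O (pairIndex i 0) * rotatedMajorana O (pairIndex i 1))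
      (rotatedMajorana O (pairIndex j b)) := by
    intro b
    rw [Commute, SemiconjBy, mul_assoc, h, mul_neg, ← mul_assoc, h, neg_mul, neg_neg, mul_assoc]
  exact (h1 0).mul_right (h1 1)

/-- The projection onto the eigenspace of `γ_{R_j}^O` with eigenvalue `q`. -/
noncomputable def modeProj (O : Matrix (Fin (2 * n)) (Fin (2 * n)) ℝ) (j : Fin n) (q : ℤˣ) :
    FockOp n :=
  (1 / 2 : ℂ) • (1 + ((q : ℤ) : ℂ) • rotated O (modePair j))

lemma units_cast_mul_self (q : ℤˣ) : ((q : ℤ) : ℂ) * ((q : ℤ) : ℂ) = 1 := by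
  rcases Int.units_eq_one_or q with h | h <;> simp [h]

lemma modeProj_mul_self (hO : O * Oᵀ = 1) (j : Fin n) (q : ℤˣ) :
    modeProj O j q * modeProj O j q = modeProj O j q := by
  have h : (1 + ((q : ℤ) : ℂ) • rotated O (modePair j)) *
      (1 + ((q : ℤ) : ℂ) • rotated O (modePair j)) =
      (2 : ℂ) • (1 + ((q : ℤ) : ℂ) • rotated O (modePair j)) := by
    rw [mul_add, add_mul, add_mul, smul_mul_smul_comm, units_cast_mul_self,
      rotated_modePair_mul_self hO, two_smul]
    simp only [one_mul, mul_one, one_smul]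
    abel
  unfold modeProj
  rw [smul_mul_smul_comm, h, smul_smul]
  norm_num

lemma modeProj_conjTranspose (hO : O * Oᵀ = 1) (j : Fin n) (q : ℤˣ) :
    (modeProj O j q)ᴴ = modeProj O j q := by
  simp [modeProj, Matrix.conjTranspose_smul, rotated_modePair_conjTranspose hO]

lemma modeProj_commute (hO : O * Oᵀ = 1) (i j : Fin n) (q q' : ℤˣ) :
    Commute (modeProj O i q) (modeProj O j q') := by
  unfold modeProj
  refine Commute.smul_left (Commute.smul_right ?_ _) _
  refine Commute.add_left (Commute.one_left _) (Commute.add_right (Commute.one_right _) ?_)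
  exact ((rotated_modePair_commute hO i j).smul_left _).smul_right _

/-- The joint projection of the observables `γ_{R_j}^O` onto the outcomes `q`. -/
noncomputable def jointProj (O : Matrix (Fin (2 * n)) (Fin (2 * n)) ℝ) (q : Fin n → ℤˣ) :
    FockOp n :=
  (List.ofFn fun j => modeProj O j (q j)).prod

/-- Since the projections commute and are idempotent, `P Q = P Q P` for each new factor `P`, and
compression by `P` preserves positivity. -/
lemma jointProj_posSemidef (hO : O * Oᵀ = 1) (q : Fin n → ℤˣ) : (jointProj O q).PosSemidef := by
  have key : ∀ l : List (Fin n), (l.map fun j => modeProj O j (q j)).prod.PosSemidef := by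
    intro l
    induction l with
    | nil => simpa using Matrix.PosSemidef.one
    | cons a l ih =>
      have hc : Commute (modeProj O a (q a)) (l.map fun j => modeProj O j (q j)).prod := by
        refine Commute.list_prod_right _ _ fun x hx => ?_
        obtain ⟨j, -, rfl⟩ := List.mem_map.1 hx
        exact modeProj_commute hO _ _ _ _
      have h : modeProj O a (q a) * (l.map fun j => modeProj O j (q j)).prod =
          (modeProj O a (q a))ᴴ * (l.map fun j => modeProj O j (q j)).prod *
            modeProj O a (q a) := by
        rw [modeProj_conjTranspose hO, mul_assoc, ← hc.eq, ← mul_assoc, modeProj_mul_self hO]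
      rw [List.map_cons, List.prod_cons, h]
      exact ih.conjTranspose_mul_mul_same _
  have := key (List.finRange n)
  rwa [← List.ofFn_eq_map] at this

lemma sum_jointProj (O : Matrix (Fin (2 * n)) (Fin (2 * n)) ℝ) : ∑ q, jointProj O q = 1 := by
  have h := (MultilinearMap.mkPiAlgebraFin ℂ n (FockOp n)).map_sum (fun j q => modeProj O j q)
  simp only [MultilinearMap.mkPiAlgebraFin_apply] at h
  have h1 : ∀ j : Fin n, ∑ q : ℤˣ, modeProj O j q = 1 := by
    intro j
    rw [UnitsInt.univ, Finset.sum_pair (by decide)]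
    unfold modeProj
    rw [← smul_add]
    simp only [Units.val_one, Units.val_neg, Int.cast_one, Int.cast_neg, one_smul, neg_smul]
    rw [add_add_add_comm, add_neg_cancel, add_zero, ← two_smul ℂ, smul_smul]
    norm_num
  simp only [h1] at h
  rw [show (List.ofFn fun _ : Fin n => (1 : FockOp n)).prod = 1 from by simp] at h
  exact h.symm

/-- Between consecutive factors `γ_X γ_X†` cancels, so a single conjugation remains. The prefactor
absorbs all but one of the `n` normalisations `2 ^ (-2 n)`. -/
lemma parentPOVM_eq (hn : 0 < n) (O : Matrix (Fin (2 * n)) (Fin (2 * n)) ℝ) (l : Outcome n) :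
    parentPOVM O l =
      ((2 : ℂ) ^ (2 * n))⁻¹ • ((monomial l.2)ᴴ * jointProj O l.1 * monomial l.2) := by
  have hconj : ∀ L : List (Fin n),
      (L.map fun j => (monomial l.2)ᴴ * modeProj O j (l.1 j) * monomial l.2).prod =
      (monomial l.2)ᴴ * (L.map fun j => modeProj O j (l.1 j)).prod * monomial l.2 := by
    intro L
    induction L with
    | nil => simp [monomial_conjTranspose_mul]
    | cons a L ih =>
      rw [List.map_cons, List.prod_cons, ih, List.map_cons, List.prod_cons]
      simp only [mul_assoc]
      rw [← mul_assoc (monomial l.2) (monomial l.2)ᴴ, monomial_mul_conjTranspose, one_mul]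
  have h := MultilinearMap.map_smul_univ (MultilinearMap.mkPiAlgebraFin ℂ n (FockOp n))
      (fun _ => ((2 : ℂ) ^ (2 * n))⁻¹)
      (fun j => (monomial l.2)ᴴ * modeProj O j (l.1 j) * monomial l.2)
  simp only [MultilinearMap.mkPiAlgebraFin_apply, Finset.prod_const, Finset.card_univ,
    Fintype.card_fin] at h
  have hj := hconj (List.finRange n)
  rw [← List.ofFn_eq_map, ← List.ofFn_eq_map] at hj
  unfold parentPOVM
  change _ • (List.ofFn fun j => ((2 : ℂ) ^ (2 * n))⁻¹ •
    ((monomial l.2)ᴴ * modeProj O j (l.1 j) * monomial l.2)).prod = _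
  rw [h, hj, smul_smul]
  congr 1
  obtain ⟨m, rfl⟩ : ∃ m, n = m + 1 := ⟨n - 1, by omega⟩
  rw [Nat.add_sub_cancel, pow_succ, ← mul_assoc, ← mul_pow, mul_inv_cancel₀ (by positivity),
    one_pow, one_mul]

lemma parentPOVM_isPOVM (hn : 0 < n) (hO : O * Oᵀ = 1) : IsPOVM (parentPOVM O) := by
  constructor
  · intro l
    rw [parentPOVM_eq hn]
    refine Matrix.PosSemidef.smul ((jointProj_posSemidef hO _).conjTranspose_mul_mul_same _) ?_
    rw [inv_nonneg]
    exact_mod_cast (by positivity : (0 : ℝ) ≤ 2 ^ (2 * n))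
  · simp only [parentPOVM_eq hn, ← Finset.smul_sum, Fintype.sum_prod_type_right]
    simp only [← Finset.sum_mul, ← Finset.mul_sum, sum_jointProj, mul_one,
      monomial_conjTranspose_mul]
    rw [Finset.sum_const, Finset.card_univ, Fintype.card_finset, Fintype.card_fin,
      ← Nat.cast_smul_eq_nsmul ℂ, smul_smul]
    push_cast
    rw [inv_mul_cancel₀ (by positivity), one_smul]

lemma ofFn_piecewise_prod {M : Type*} [Monoid M] (x : Fin n → M) (A : Finset (Fin n)) :
    (List.ofFn (A.piecewise x 1)).prod =
      (List.ofFn fun i => x (A.orderEmbOfFin rfl i)).prod := by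
  classical
  have h1 : ∀ l : List (Fin n), (l.map (A.piecewise x 1)).prod =
      ((l.filter (· ∈ A)).map x).prod := by
    intro l
    induction l with
    | nil => simp
    | cons a l ih => by_cases h : a ∈ A <;> simp [h, ih]
  have h2 : (List.finRange n).filter (· ∈ A) = A.sort (· ≤ ·) := by
    refine List.Perm.eq_of_sortedLE ?_ ?_ ?_
    · exact ((List.sortedLT_finRange n).sortedLE.pairwise.filter _).sortedLE
    · exact (Finset.pairwise_sort A (· ≤ ·)).sortedLE
    · refine (List.perm_ext_iff_of_nodup ((List.nodup_finRange n).filter _)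
        (Finset.sort_nodup _ _)).2 fun a => by simp
  rw [List.ofFn_eq_map, h1, h2]
  congr 1
  apply List.ext_getElem
  · simp
  · intro i _ _
    simp [Finset.orderEmbOfFin_apply]

/-- The coefficient of `γ_S` in the product of the `γ_{R_j}^O`, `j ∈ A`. -/
noncomputable def pairMinor (O : Matrix (Fin (2 * n)) (Fin (2 * n)) ℝ) {k : ℕ}
    (S : DegSet n (k * 2)) (A : Finset (Fin n)) : ℝ :=
  if h : A.card = k then
    (O.submatrix (pairRow (A.orderEmbOfFin h)) (S.1.orderEmbOfFin S.2)).det else 0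

lemma jointProj_eq_sum (O : Matrix (Fin (2 * n)) (Fin (2 * n)) ℝ) (q : Fin n → ℤˣ) :
    jointProj O q = ((2 : ℂ) ^ n)⁻¹ • ∑ A : Finset (Fin n), (∏ j ∈ A, ((q j : ℤ) : ℂ)) •
      (List.ofFn fun i => rotated O (modePair (A.orderEmbOfFin rfl i))).prod := by
  have h := MultilinearMap.map_smul_univ (MultilinearMap.mkPiAlgebraFin ℂ n (FockOp n))
    (fun _ => (1 / 2 : ℂ)) (fun j => 1 + ((q j : ℤ) : ℂ) • rotated O (modePair j))
  have h' := MultilinearMap.map_add_univ (MultilinearMap.mkPiAlgebraFin ℂ n (FockOp n))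
    (fun j => ((q j : ℤ) : ℂ) • rotated O (modePair j)) 1
  simp only [MultilinearMap.mkPiAlgebraFin_apply, Finset.prod_const, Finset.card_univ,
    Fintype.card_fin] at h h'
  have hc : (fun j : Fin n => 1 + ((q j : ℤ) : ℂ) • rotated O (modePair j)) =
    (fun j => ((q j : ℤ) : ℂ) • rotated O (modePair j)) + 1 := funext fun j => add_comm _ _
  unfold jointProj modeProj
  rw [h]
  rw [hc, h', one_div, inv_pow]
  congr 1
  refine Finset.sum_congr rfl fun A _ => ?_
  rw [ofFn_piecewise_prod]
  have h2 := MultilinearMap.map_smul_univ (MultilinearMap.mkPiAlgebraFin ℂ A.card (FockOp n))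
    (fun i => ((q (A.orderEmbOfFin rfl i) : ℤ) : ℂ))
    (fun i => rotated O (modePair (A.orderEmbOfFin rfl i)))
  simp only [MultilinearMap.mkPiAlgebraFin_apply] at h2
  rw [h2]
  congr 1
  conv_rhs => rw [← Finset.map_orderEmbOfFin_univ A rfl, Finset.prod_map]
  rfl

/-- Twirling the joint projection with the character of `S` gives a multiple of `γ_S`. -/
lemma sum_parity_smul_parentPOVM (hn : 0 < n) (hO : O * Oᵀ = 1) {k : ℕ} (S : DegSet n (k * 2))
    (q : Fin n → ℤˣ) :
    ∑ X, (parity S.1 X : ℂ) • parentPOVM O (q, X) =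
      ((2 : ℂ) ^ n)⁻¹ • (((∑ A : Finset (Fin n), pairMinor O S A * ∏ j ∈ A, ((q j : ℤ) : ℝ) : ℝ) : ℂ)
        • monomial S.1) := by
  -- The product over `A` contains only monomials of degree `2 |A|`. The twirl selects the
  -- coefficient of `γ_S`, which can be nonzero only for `|A| = k`; this is why `pairMinor` is `0`
  -- otherwise.
  have hA : ∀ A : Finset (Fin n), ∑ X, (parity S.1 X : ℂ) • ((monomial X)ᴴ *
      (List.ofFn fun i => rotated O (modePair (A.orderEmbOfFin rfl i))).prod * monomial X) =
      ((2 : ℂ) ^ (2 * n) * (pairMinor O S A : ℂ)) • monomial S.1 := by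
    intro A
    rw [ofFn_rotated_modePair_prod hO (A.orderEmbOfFin rfl).injective]
    simp only [Finset.mul_sum, Finset.sum_mul, Finset.smul_sum, mul_smul_comm, smul_mul_assoc]
    rw [Finset.sum_comm]
    have h1 : ∀ T : DegSet n (A.card * 2), Even T.1.card := fun T => ⟨A.card, by rw [T.2]; ring⟩
    have h2 : ∀ (c : ℂ) (T : DegSet n (A.card * 2)), ∑ X, (parity S.1 X : ℂ) • c •
        ((monomial X)ᴴ * monomial T.1 * monomial X) =
        c • if S.1 = T.1 then (2 : ℂ) ^ (2 * n) • monomial S.1 else 0 := by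
      intro c T
      rw [← sum_parity_smul_conj _ _ (h1 T), Finset.smul_sum]
      exact Finset.sum_congr rfl fun X _ => smul_comm _ _ _
    simp only [h2]
    by_cases hk : A.card = k
    · subst hk
      rw [Finset.sum_eq_single S]
      · simp only [if_true, pairMinor, dif_pos, smul_smul]
        rw [mul_comm]
      · intro T _ hT
        rw [if_neg fun h => hT (Subtype.ext h.symm), smul_zero]
      · simp
    · rw [Finset.sum_eq_zero]
      · simp [pairMinor, hk]
      · intro T _
        rw [if_neg, smul_zero]
        intro h
        have := congrArg Finset.card h
        rw [S.2, T.2] at this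
        omega
  have hX : ∀ X, (parity S.1 X : ℂ) • parentPOVM O (q, X) =
      (((2 : ℂ) ^ (2 * n))⁻¹ * ((2 : ℂ) ^ n)⁻¹) • ∑ A : Finset (Fin n), (∏ j ∈ A, ((q j : ℤ) : ℂ)) •
        ((parity S.1 X : ℂ) • ((monomial X)ᴴ *
          (List.ofFn fun i => rotated O (modePair (A.orderEmbOfFin rfl i))).prod *
            monomial X)) := by
    intro X
    rw [parentPOVM_eq hn, jointProj_eq_sum]
    simp only [mul_smul_comm, smul_mul_assoc, Finset.mul_sum, Finset.sum_mul, Finset.smul_sum,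
      smul_smul]
    refine Finset.sum_congr rfl fun A _ => ?_
    congr 1
    ring
  simp only [hX]
  rw [← Finset.smul_sum, Finset.sum_comm]
  simp only [← Finset.smul_sum, hA]
  simp only [smul_smul, ← Finset.sum_smul]
  congr 1
  push_cast
  rw [Finset.mul_sum, Finset.mul_sum]
  refine Finset.sum_congr rfl fun A _ => ?_
  field_simp

end Parent

/-! ### Moments of polynomials in independent signs -/

section Hypercontractivity

variable {ι : Type*} [DecidableEq ι]

/-- The multilinear polynomial in the signs `q j`, `j ∈ U`, with coefficients `a`. -/
def signPoly (U : Finset ι) (a : Finset ι → ℝ) (q : ι → ℤˣ) : ℝ :=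
  ∑ A ∈ U.powerset, a A * ∏ j ∈ A, ((q j : ℤ) : ℝ)

lemma signPoly_update {U : Finset ι} {i : ι} (hi : i ∉ U) (a : Finset ι → ℝ) (q : ι → ℤˣ) (x : ℤˣ) :
    signPoly U a (Function.update q i x) = signPoly U a q := by
  refine Finset.sum_congr rfl fun A hA => ?_
  congr 1
  refine Finset.prod_congr rfl fun j hj => ?_
  rw [Function.update_of_ne]
  rintro rfl
  exact hi (Finset.mem_powerset.1 hA hj)

lemma signPoly_insert {U : Finset ι} {i : ι} (hi : i ∉ U) (a : Finset ι → ℝ) (q : ι → ℤˣ) :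
    signPoly (insert i U) a q =
      signPoly U a q + ((q i : ℤ) : ℝ) * signPoly U (fun A => a (insert i A)) q := by
  unfold signPoly
  rw [Finset.sum_powerset_insert hi, Finset.mul_sum]
  congr 1
  refine Finset.sum_congr rfl fun A hA => ?_
  rw [Finset.prod_insert fun h => hi (Finset.mem_powerset.1 hA h)]
  ring

variable [Fintype ι]

lemma sum_sign_mul_eq_zero (i : ι) (g : (ι → ℤˣ) → ℝ)
    (hg : ∀ q, g (Function.update q i (-q i)) = g q) : ∑ q, ((q i : ℤ) : ℝ) * g q = 0 := by
  refine Finset.sum_involution (fun q _ => Function.update q i (-q i)) ?_ ?_ (by simp) (by simp)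
  · intro q _
    rw [hg]
    simp
  · intro q _ _ h
    have := congrFun h i
    rw [Function.update_self] at this
    rcases Int.units_eq_one_or (q i) with h' | h' <;> rw [h'] at this <;> revert this <;> decide

lemma sign_sq (x : ℤˣ) : ((x : ℤ) : ℝ) ^ 2 = 1 := by
  rcases Int.units_eq_one_or x with h | h <;> simp [h]

/-- Parseval, by splitting off one variable: in `f = g + q_i h` neither `g` nor `h` depends on
`q_i`, so flipping `q_i` shows that the cross term sums to zero. -/
lemma sum_signPoly_sq (U : Finset ι) (a : Finset ι → ℝ) :
    ∑ q, signPoly U a q ^ 2 = 2 ^ Fintype.card ι * ∑ A ∈ U.powerset, a A ^ 2 := by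
  induction U using Finset.induction_on generalizing a with
  | empty =>
    simp [signPoly]
  | insert i U hi ih =>
    have h0 := sum_sign_mul_eq_zero i
      (fun q => 2 * (signPoly U a q * signPoly U (fun A => a (insert i A)) q))
      fun q => by simp only [signPoly_update hi]
    rw [Finset.sum_powerset_insert hi, mul_add, ← ih a, ← ih fun A => a (insert i A),
      ← Finset.sum_add_distrib, ← sub_eq_zero, ← Finset.sum_sub_distrib, ← h0]
    refine Finset.sum_congr rfl fun q _ => ?_
    rw [signPoly_insert hi]
    linear_combination (signPoly U (fun A => a (insert i A)) q) ^ 2 * sign_sq (q i)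

/-- Hypercontractivity of polynomials of degree at most `k` in independent signs, for the second
and fourth moments. -/
lemma sum_signPoly_pow_four_le (U : Finset ι) (a : Finset ι → ℝ) (k : ℕ)
    (ha : ∀ A, a A ≠ 0 → A.card ≤ k) :
    ∑ q, signPoly U a q ^ 4 ≤
      2 ^ Fintype.card ι * 9 ^ k * (∑ A ∈ U.powerset, a A ^ 2) ^ 2 := by
  induction U using Finset.induction_on generalizing a k with
  | empty =>
    simp only [signPoly, Finset.powerset_empty, Finset.sum_singleton, Finset.prod_empty, mul_one,
      Finset.sum_const, Finset.card_univ, Fintype.card_pi, Fintype.card_units_int,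
      Finset.prod_const, nsmul_eq_mul]
    push_cast
    have h9 : (1 : ℝ) ≤ 9 ^ k := one_le_pow₀ (by norm_num)
    have : 0 ≤ (2 : ℝ) ^ Fintype.card ι * a ∅ ^ 4 := by positivity
    nlinarith
  | insert i U hi ih =>
    -- Here `b` holds the coefficients of `h` in `f = g + q_i h`. Setting `b` to zero on sets
    -- containing `i` changes nothing on subsets of `U` and makes the degree bound drop by one for
    -- every `A`.
    set b : Finset ι → ℝ := fun A => if i ∈ A then 0 else a (insert i A) with hb
    have hbU : ∀ q, signPoly U (fun A => a (insert i A)) q = signPoly U b q := by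
      intro q
      refine Finset.sum_congr rfl fun A hA => ?_
      rw [hb]
      simp only
      rw [if_neg fun h => hi (Finset.mem_powerset.1 hA h)]
    have hbs : ∑ A ∈ U.powerset, a (insert i A) ^ 2 = ∑ A ∈ U.powerset, b A ^ 2 := by
      refine Finset.sum_congr rfl fun A hA => ?_
      rw [hb]
      simp only
      rw [if_neg fun h => hi (Finset.mem_powerset.1 hA h)]
    have hbcard : ∀ A, b A ≠ 0 → A.card + 1 ≤ k := by
      intro A hA
      rw [hb] at hA
      simp only at hA
      split_ifs at hA with h
      · exact absurd rfl hA
      · have := ha _ hA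
        rwa [Finset.card_insert_of_notMem h] at this
    rw [Finset.sum_powerset_insert hi, hbs]
    have hα := ih a k ha
    set α := ∑ A ∈ U.powerset, a A ^ 2 with hαd
    set β := ∑ A ∈ U.powerset, b A ^ 2 with hβd
    have hα0 : 0 ≤ α := Finset.sum_nonneg fun _ _ => sq_nonneg _
    have hβ0 : 0 ≤ β := Finset.sum_nonneg fun _ _ => sq_nonneg _
    have hexp : ∑ q, signPoly (insert i U) a q ^ 4 = ∑ q, signPoly U a q ^ 4 +
        6 * ∑ q, signPoly U a q ^ 2 * signPoly U b q ^ 2 + ∑ q, signPoly U b q ^ 4 := by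
      have h0 := sum_sign_mul_eq_zero i
        (fun q => 4 * (signPoly U a q ^ 3 * signPoly U b q + signPoly U a q * signPoly U b q ^ 3))
        fun q => by simp only [signPoly_update hi]
      rw [Finset.mul_sum, ← Finset.sum_add_distrib, ← Finset.sum_add_distrib, ← sub_eq_zero,
        ← Finset.sum_sub_distrib, ← h0]
      refine Finset.sum_congr rfl fun q _ => ?_
      rw [signPoly_insert hi, hbU]
      linear_combination (6 * signPoly U a q ^ 2 * signPoly U b q ^ 2 +
        4 * ((q i : ℤ) : ℝ) * signPoly U a q * signPoly U b q ^ 3 +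
        signPoly U b q ^ 4 * (((q i : ℤ) : ℝ) ^ 2 + 1)) * sign_sq (q i)
    rw [hexp]
    have hM : (0 : ℝ) < 2 ^ Fintype.card ι := by positivity
    set M : ℝ := 2 ^ Fintype.card ι
    cases k with
    | zero =>
      have hb0 : ∀ A, b A = 0 := fun A => by
        by_contra h
        have := hbcard A h
        omega
      have hb1 : ∀ q, signPoly U b q = 0 := fun q => by simp [signPoly, hb0]
      have hβ1 : β = 0 := by simp [hβd, hb0]
      simpa [hb1, hβ1] using hα
    | succ k =>
      have hβ := ih b k fun A hA => by have := hbcard A hA; omega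
      have hcs := Finset.sum_mul_sq_le_sq_mul_sq Finset.univ (fun q => signPoly U a q ^ 2)
        (fun q => signPoly U b q ^ 2)
      simp only [← pow_mul] at hcs
      -- Cauchy–Schwarz, with `9 ^ (k + 1) * 9 ^ k = (3 * 9 ^ k) ^ 2`. The coefficient `6` then
      -- gives `2 * 9 ^ (k + 1) * α * β`, exactly the cross term of `9 ^ (k + 1) * (α + β) ^ 2`.
      have hmid : ∑ q, signPoly U a q ^ 2 * signPoly U b q ^ 2 ≤ M * (3 * 9 ^ k * α * β) := by
        refine (abs_le_of_sq_le_sq' ?_ (by positivity)).2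
        refine hcs.trans ((mul_le_mul hα hβ (Finset.sum_nonneg fun _ _ => by positivity)
          (by positivity)).trans (le_of_eq ?_))
        ring
      have : (0 : ℝ) ≤ M * 9 ^ k * β ^ 2 := by positivity
      rw [pow_succ] at hα ⊢
      nlinarith

/-- The first moment of a polynomial of degree at most `k` in independent signs is comparable with
its standard deviation. -/
lemma le_sum_abs_signPoly (a : Finset ι → ℝ) (k : ℕ) (ha : ∀ A, a A ≠ 0 → A.card ≤ k) :
    2 ^ Fintype.card ι * (√(∑ A, a A ^ 2) / (3 * 3 ^ k)) ≤ ∑ q, |signPoly Finset.univ a q| := by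
  set s := √(∑ A, a A ^ 2) with hs
  have hs2 : s ^ 2 = ∑ A, a A ^ 2 := Real.sq_sqrt (Finset.sum_nonneg fun _ _ => sq_nonneg _)
  have hs0 : 0 ≤ s := Real.sqrt_nonneg _
  rcases hs0.eq_or_lt with h0 | h0
  · rw [← h0, zero_div, mul_zero]
    exact Finset.sum_nonneg fun _ _ => abs_nonneg _
  have h2 := sum_signPoly_sq Finset.univ a
  have h4 := sum_signPoly_pow_four_le Finset.univ a k ha
  rw [Finset.powerset_univ, ← hs2] at h2 h4
  -- This scale, close to the optimal one, leaves the factor `2 / 3 - 8 / 27 = 10 / 27`, which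
  -- exceeds the `1 / 3` that is claimed.
  set t := 3 / 2 * 3 ^ k * s with ht
  have htpos : 0 < t := by positivity
  -- Only even moments appear on the left, so summing bounds the first absolute moment by the second
  -- and the fourth. In units of `t` it says `y ^ 2 - y ^ 4 ≤ y` for `y ≥ 0`.
  have hpt : ∀ x : ℝ, x ^ 2 / t - x ^ 4 / t ^ 3 ≤ |x| := by
    intro x
    have h1 : x ^ 2 / t - x ^ 4 / t ^ 3 = t * ((|x| / t) ^ 2 - (|x| / t) ^ 4) := by
      rw [div_pow, div_pow, sq_abs, show |x| ^ 4 = x ^ 4 from Even.pow_abs (by decide) x]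
      field_simp
    have h2 : |x| = t * (|x| / t) := by field_simp
    rw [h1]
    conv_rhs => rw [h2]
    refine mul_le_mul_of_nonneg_left ?_ htpos.le
    have hy : 0 ≤ |x| / t := by positivity
    rcases le_total (|x| / t) 1 with h | h
    · nlinarith [pow_nonneg hy 4]
    · nlinarith [pow_le_pow_right₀ h (show 2 ≤ 4 by norm_num)]
  have hsum := Finset.sum_le_sum fun q (_ : q ∈ Finset.univ) => hpt (signPoly Finset.univ a q)
  rw [Finset.sum_sub_distrib, ← Finset.sum_div, ← Finset.sum_div, h2] at hsum
  refine le_trans ?_ hsum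
  have h5 : (∑ q, signPoly Finset.univ a q ^ 4) / t ^ 3 ≤
      2 ^ Fintype.card ι * 9 ^ k * (s ^ 2) ^ 2 / t ^ 3 := by gcongr
  have h6 : 2 ^ Fintype.card ι * 9 ^ k * (s ^ 2) ^ 2 / t ^ 3 =
      2 ^ Fintype.card ι * (8 / 27 * (s / 3 ^ k)) := by
    rw [ht, show (9 : ℝ) ^ k = 3 ^ k * 3 ^ k by rw [← mul_pow]; norm_num]
    field_simp
    ring
  have h7 : 2 ^ Fintype.card ι * s ^ 2 / t = 2 ^ Fintype.card ι * (2 / 3 * (s / 3 ^ k)) := by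
    rw [ht]; field_simp
  have h8 : s / (3 * 3 ^ k) = 1 / 3 * (s / 3 ^ k) := by field_simp
  rw [h7, h8]
  have h9 : 0 < (2 : ℝ) ^ Fintype.card ι * (s / 3 ^ k) := by positivity
  nlinarith

end Hypercontractivity

/-! ### The odd-frequency Fourier matrix and its minors -/

section OddFourier

variable {n : ℕ}

lemma two_mul_sin_mul_sum_cos (φ : ℝ) (m : ℕ) :
    2 * Real.sin φ * ∑ j ∈ Finset.range m, Real.cos ((2 * j + 1) * φ) = Real.sin (2 * m * φ) := by
  induction m with
  | zero => simp
  | succ m ih =>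
    rw [Finset.sum_range_succ, mul_add, ih]
    have h1 : 2 * (m : ℝ) * φ = (2 * m + 1) * φ - φ := by ring
    have h2 : 2 * ((m + 1 : ℕ) : ℝ) * φ = (2 * m + 1) * φ + φ := by push_cast; ring
    rw [h1, h2, Real.sin_sub, Real.sin_add]
    ring

/-- With `φ = π D / (2 n)`, the telescoped sum times `2 sin φ` is `sin (D π) = 0`. So the sum
vanishes unless `sin φ = 0`, which forces `2 n ∣ D`; in that case all terms are the same sign. -/
lemma sum_cos_odd (hn : 0 < n) (D : ℤ) :
    ∃ z : ℤ, ∑ j : Fin n, Real.cos ((2 * (j : ℕ) + 1) * (Real.pi * D / (2 * n))) = n * z ∧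
      (¬ (2 * n : ℤ) ∣ D → z = 0) := by
  have hn' : (n : ℝ) ≠ 0 := by positivity
  rw [Fin.sum_univ_eq_sum_range (fun j => Real.cos ((2 * (j : ℝ) + 1) * (Real.pi * D / (2 * n))))]
  by_cases hD : (2 * n : ℤ) ∣ D
  · obtain ⟨m, rfl⟩ := hD
    refine ⟨m.negOnePow, ?_, fun h => absurd (dvd_mul_right _ _) h⟩
    rw [Finset.sum_congr rfl (g := fun _ => ((m.negOnePow : ℤ) : ℝ))]
    · simp
    · intro j _
      have : (2 * (j : ℝ) + 1) * (Real.pi * ((2 * n * m : ℤ) : ℝ) / (2 * n)) =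
          ((m * (2 * j + 1) : ℤ) : ℝ) * Real.pi := by
        push_cast; field_simp
      rw [this, Real.cos_int_mul_pi]
      have hodd : m.negOnePow = (m * (2 * j + 1)).negOnePow := by
        rw [mul_add, Int.negOnePow_add, mul_one,
          Int.negOnePow_even (m * (2 * j)) ⟨m * j, by ring⟩, one_mul]
      rw [hodd, Int.cast_negOnePow]
  · refine ⟨0, ?_, fun _ => rfl⟩
    have h := two_mul_sin_mul_sum_cos (Real.pi * D / (2 * n)) n
    have h0 : 2 * (n : ℝ) * (Real.pi * D / (2 * n)) = D * Real.pi := by field_simp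
    rw [h0, Real.sin_int_mul_pi] at h
    have hs : Real.sin (Real.pi * D / (2 * n)) ≠ 0 := by
      intro hs
      obtain ⟨m, hm⟩ := Real.sin_eq_zero_iff.1 hs
      refine hD ⟨m, ?_⟩
      have hpi := Real.pi_ne_zero
      field_simp at hm
      have hm' : D = m * 2 * n := by exact_mod_cast hm.symm
      rw [hm']; ring
    simpa [hs] using h

/-- The real odd-frequency Fourier matrix: the rows of mode `j` are
`cos ((2 j + 1) π s / (2 n)) / √n` and `sin ((2 j + 1) π s / (2 n)) / √n`. -/
noncomputable def oddFourier (n : ℕ) : Matrix (Fin (2 * n)) (Fin (2 * n)) ℝ :=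
  Matrix.of fun r s => (√n)⁻¹ *
    (if r.val % 2 = 0 then Real.cos ((2 * (r.val / 2 : ℕ) + 1) * (Real.pi * s / (2 * n)))
    else Real.sin ((2 * (r.val / 2 : ℕ) + 1) * (Real.pi * s / (2 * n))))

lemma oddFourier_zero (j : Fin n) (s : Fin (2 * n)) : oddFourier n (pairIndex j 0) s =
    (√n)⁻¹ * Real.cos ((2 * (j : ℕ) + 1) * (Real.pi * s / (2 * n))) := by
  simp [oddFourier, pairIndex]

lemma oddFourier_one (j : Fin n) (s : Fin (2 * n)) : oddFourier n (pairIndex j 1) s =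
    (√n)⁻¹ * Real.sin ((2 * (j : ℕ) + 1) * (Real.pi * s / (2 * n))) := by
  have h1 : (2 * j.val + 1) % 2 = 1 := by omega
  have h2 : (2 * j.val + 1) / 2 = j.val := by omega
  simp [oddFourier, pairIndex, h1, h2]

lemma sum_pairIndex {M : Type*} [AddCommMonoid M] (F : Fin (2 * n) → M) :
    ∑ r, F r = ∑ j : Fin n, (F (pairIndex j 0) + F (pairIndex j 1)) := by
  have hb : Function.Bijective fun p : Fin n × Fin 2 => pairIndex p.1 p.2 := by
    rw [Fintype.bijective_iff_injective_and_card]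
    refine ⟨fun p q h => Prod.ext (pairIndex_inj h).1 (pairIndex_inj h).2, ?_⟩
    simp [mul_comm]
  rw [← hb.sum_comp, Fintype.sum_prod_type]
  simp only [Fin.sum_univ_two]

lemma inv_sqrt_mul_self (hn : 0 < n) : (√(n : ℝ))⁻¹ * (√n)⁻¹ = (n : ℝ)⁻¹ := by
  rw [← mul_inv, Real.mul_self_sqrt (by positivity)]

/-- The inner product of columns `s` and `t` is a cosine sum at `D = s - t`, and `|s - t| < 2 n`
excludes nonzero multiples of `2 n`. -/
lemma oddFourier_mem (hn : 0 < n) : oddFourier n ∈ Matrix.orthogonalGroup (Fin (2 * n)) ℝ := by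
  rw [Matrix.mem_orthogonalGroup_iff']
  ext s t
  have hn' : (n : ℝ) ≠ 0 := by positivity
  change ((oddFourier n)ᵀ * oddFourier n) s t = _
  rw [Matrix.mul_apply, sum_pairIndex]
  have h : ∀ j : Fin n, (oddFourier n)ᵀ s (pairIndex j 0) * oddFourier n (pairIndex j 0) t +
      (oddFourier n)ᵀ s (pairIndex j 1) * oddFourier n (pairIndex j 1) t =
      (n : ℝ)⁻¹ * Real.cos ((2 * (j : ℕ) + 1) * (Real.pi * ((s - t : ℤ) : ℝ) / (2 * n))) := by
    intro j
    rw [Matrix.transpose_apply, Matrix.transpose_apply, oddFourier_zero, oddFourier_zero,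
      oddFourier_one, oddFourier_one, ← inv_sqrt_mul_self hn]
    have : (2 * ((j : ℕ) : ℝ) + 1) * (Real.pi * ((s - t : ℤ) : ℝ) / (2 * n)) =
        (2 * (j : ℕ) + 1) * (Real.pi * s / (2 * n)) - (2 * (j : ℕ) + 1) * (Real.pi * t / (2 * n)) := by
      push_cast; ring
    rw [this, Real.cos_sub]
    ring
  simp only [h, ← Finset.mul_sum]
  rcases eq_or_ne s t with rfl | hst
  · simp [hn']
  · obtain ⟨z, hz, hz0⟩ := sum_cos_odd hn (s - t : ℤ)
    rw [hz, hz0, Matrix.one_apply_ne hst]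
    · simp
    · intro hd
      have := Int.eq_zero_of_abs_lt_dvd hd (by rw [abs_lt]; omega)
      exact hst (Fin.ext (by omega))

lemma cos_mul_sin_mul_cos_mul_sin (a b c d : ℝ) :
    8 * (Real.cos a * Real.sin b * (Real.cos c * Real.sin d)) =
      Real.cos (a - c + b - d) + Real.cos (a - c - b + d) + Real.cos (a + c + b - d) +
      Real.cos (a + c - b + d) - Real.cos (a - c + b + d) - Real.cos (a - c - b - d) -
      Real.cos (a + c + b + d) - Real.cos (a + c - b - d) := by
  simp only [Real.cos_add, Real.cos_sub, Real.sin_add, Real.sin_sub]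
  ring

/-- Product-to-sum formulas give eight signed cosines with weight `1 / 8`, at integer combinations
of the column indices. The four normalisations contribute `n ^ (-2)`, so after scaling each cosine
sum is divided by `n`, which makes it an integer. -/
lemma sum_oddFourier_mem_range (hn : 0 < n) (a b c d : Fin (2 * n)) :
    8 * n * ∑ j : Fin n, oddFourier n (pairIndex j 0) a * oddFourier n (pairIndex j 1) b *
      (oddFourier n (pairIndex j 0) c * oddFourier n (pairIndex j 1) d) ∈
      (Int.castRingHom ℝ).range := by
  have hn' : (n : ℝ) ≠ 0 := by positivity
  set C : ℤ → ℝ := fun D => (n : ℝ)⁻¹ *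
    ∑ j : Fin n, Real.cos ((2 * (j : ℕ) + 1) * (Real.pi * D / (2 * n))) with hC
  have hmem : ∀ D, C D ∈ (Int.castRingHom ℝ).range := by
    intro D
    obtain ⟨z, hz, -⟩ := sum_cos_odd hn D
    refine ⟨z, ?_⟩
    rw [hC]
    simp only [hz]
    rw [inv_mul_cancel_left₀ hn']
    rfl
  have key : 8 * n * ∑ j : Fin n, oddFourier n (pairIndex j 0) a * oddFourier n (pairIndex j 1) b *
      (oddFourier n (pairIndex j 0) c * oddFourier n (pairIndex j 1) d) =
      C (a - c + b - d) + C (a - c - b + d) + C (a + c + b - d) + C (a + c - b + d) -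
      C (a - c + b + d) - C (a - c - b - d) - C (a + c + b + d) - C (a + c - b - d) := by
    rw [hC]
    simp only [← mul_add, ← mul_sub, ← Finset.sum_add_distrib, ← Finset.sum_sub_distrib]
    rw [Finset.mul_sum, Finset.mul_sum]
    refine Finset.sum_congr rfl fun j _ => ?_
    set w : ℝ := (2 * (j : ℕ) + 1) * (Real.pi / (2 * n)) with hw
    have hD : ∀ x : ℝ, (2 * ((j : ℕ) : ℝ) + 1) * (Real.pi * x / (2 * n)) = w * x := by
      intro x; rw [hw]; ring
    have h8 := cos_mul_sin_mul_cos_mul_sin (w * a) (w * b) (w * c) (w * d)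
    simp only [oddFourier_zero, oddFourier_one, hD]
    push_cast
    simp only [mul_add, mul_sub] at h8 ⊢
    simp only [← mul_add, ← mul_sub] at h8 ⊢
    rw [← h8]
    have hq := inv_sqrt_mul_self hn
    have hq2 : (n : ℝ) * ((√(n : ℝ))⁻¹ * (√n)⁻¹ * ((√n)⁻¹ * (√n)⁻¹)) = (n : ℝ)⁻¹ := by
      rw [hq]; field_simp
    rw [← hq2]
    ring
  rw [key]
  repeat' first | exact hmem _ | apply Subring.sub_mem | apply Subring.add_mem

lemma det_submatrix_pairRow (O : Matrix (Fin (2 * n)) (Fin (2 * n)) ℝ) {k : ℕ} (j : Fin k → Fin n)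
    (e : Fin (k * 2) → Fin (2 * n)) :
    (O.submatrix (pairRow j) e).det = ∑ σ : Equiv.Perm (Fin (k * 2)),
      ((Equiv.Perm.sign σ : ℤ) : ℝ) * ∏ m : Fin k,
        (O (pairIndex (j m) 0) (e (σ (finProdFinEquiv (m, 0)))) *
          O (pairIndex (j m) 1) (e (σ (finProdFinEquiv (m, 1))))) := by
  rw [← Matrix.det_transpose, Matrix.det_apply']
  refine Finset.sum_congr rfl fun σ _ => ?_
  congr 1
  rw [← finProdFinEquiv.prod_comp, Fintype.prod_prod_type]
  refine Finset.prod_congr rfl fun m _ => ?_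
  simp only [Fin.prod_univ_two, Matrix.transpose_apply, Matrix.submatrix_apply, pairRow,
    Equiv.symm_apply_apply]

/-- Expanding the squared determinant over two permutations makes the sum over all tuples `j`,
repetitions included, factorise into `k` sums over a single mode. Each takes one factor `8 n` and
becomes an integer. -/
lemma sum_det_sq_mem_range (hn : 0 < n) {k : ℕ} (e : Fin (k * 2) → Fin (2 * n)) :
    (8 * n : ℝ) ^ k * ∑ j : Fin k → Fin n, ((oddFourier n).submatrix (pairRow j) e).det ^ 2 ∈
      (Int.castRingHom ℝ).range := by
  have key : (8 * n : ℝ) ^ k *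
      ∑ j : Fin k → Fin n, ((oddFourier n).submatrix (pairRow j) e).det ^ 2 =
      ∑ σ : Equiv.Perm (Fin (k * 2)), ∑ τ : Equiv.Perm (Fin (k * 2)),
        ((Equiv.Perm.sign σ : ℤ) : ℝ) * ((Equiv.Perm.sign τ : ℤ) : ℝ) * ∏ m : Fin k,
          (8 * n * ∑ x : Fin n,
            oddFourier n (pairIndex x 0) (e (σ (finProdFinEquiv (m, 0)))) *
            oddFourier n (pairIndex x 1) (e (σ (finProdFinEquiv (m, 1)))) *
            (oddFourier n (pairIndex x 0) (e (τ (finProdFinEquiv (m, 0)))) *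
            oddFourier n (pairIndex x 1) (e (τ (finProdFinEquiv (m, 1)))))) := by
    simp only [Finset.prod_mul_distrib (f := fun _ => (8 * n : ℝ)), Finset.prod_const,
      Finset.card_univ, Fintype.card_fin, Finset.prod_univ_sum, Fintype.piFinset_univ]
    simp only [det_submatrix_pairRow, sq, Finset.sum_mul_sum]
    simp only [Finset.mul_sum]
    rw [Finset.sum_comm]
    refine Finset.sum_congr rfl fun σ _ => ?_
    rw [Finset.sum_comm]
    refine Finset.sum_congr rfl fun τ _ => ?_
    refine Finset.sum_congr rfl fun j _ => ?_
    rw [Finset.prod_mul_distrib (f := fun m : Fin k =>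
      oddFourier n (pairIndex (j m) 0) (e (σ (finProdFinEquiv (m, 0)))) *
      oddFourier n (pairIndex (j m) 1) (e (σ (finProdFinEquiv (m, 1)))))]
    ring
  rw [key]
  refine Subring.sum_mem _ fun σ _ => Subring.sum_mem _ fun τ _ => Subring.mul_mem _
    (Subring.mul_mem _ ⟨_, rfl⟩ ⟨_, rfl⟩) (Subring.prod_mem _ fun m _ => ?_)
  exact sum_oddFourier_mem_range hn _ _ _ _

/-- The minors of the lowest frequencies do not vanish. -/
lemma det_oddFourier_castLE_ne_zero {k : ℕ} (hkn : k ≤ n) (hn : 0 < n)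
    {e : Fin (k * 2) → Fin (2 * n)} (he : Function.Injective e) :
    ((oddFourier n).submatrix (pairRow (Fin.castLE hkn)) e).det ≠ 0 := by
  intro hdet
  have hn' : (n : ℝ) ≠ 0 := by positivity
  -- A kernel vector is annihilated by cosines and sines, hence by the exponentials, at the
  -- frequencies `±1, ±3, …, ±(2 k - 1)`. These are `2 k` conditions in arithmetic progression.
  obtain ⟨v, hv, hMv⟩ := Matrix.exists_mulVec_eq_zero_iff.2 hdet
  set θ : Fin (k * 2) → ℝ := fun i => Real.pi * (e i : ℕ) / (2 * n) with hθ
  have hsq : (√(n : ℝ))⁻¹ ≠ 0 := by positivity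
  have hrow : ∀ (m : Fin k) (b : Fin 2),
      ∑ i, oddFourier n (pairIndex (Fin.castLE hkn m) b) (e i) * v i = 0 := by
    intro m b
    have := congrFun hMv (finProdFinEquiv (m, b))
    simpa [Matrix.mulVec, dotProduct, pairRow] using this
  have hcos : ∀ m : Fin k, ∑ i, Real.cos ((2 * (m : ℕ) + 1) * θ i) * v i = 0 := by
    intro m
    have := hrow m 0
    simp only [oddFourier_zero, mul_assoc, ← Finset.mul_sum] at this
    simpa [hsq] using this
  have hsin : ∀ m : Fin k, ∑ i, Real.sin ((2 * (m : ℕ) + 1) * θ i) * v i = 0 := by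
    intro m
    have := hrow m 1
    simp only [oddFourier_one, mul_assoc, ← Finset.mul_sum] at this
    simpa [hsq] using this
  have hexp : ∀ (m : Fin k) (ε : ℝ), (ε = 1 ∨ ε = -1) →
      ∑ i, (v i : ℂ) * Complex.exp (((ε * ((2 * (m : ℕ) + 1) * θ i) : ℝ) : ℂ) * Complex.I) = 0 := by
    intro m ε hε
    have h : ∀ i, (v i : ℂ) * Complex.exp (((ε * ((2 * (m : ℕ) + 1) * θ i) : ℝ) : ℂ) * Complex.I) =
        ((Real.cos ((2 * (m : ℕ) + 1) * θ i) * v i : ℝ) : ℂ) +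
        (ε : ℂ) * Complex.I * ((Real.sin ((2 * (m : ℕ) + 1) * θ i) * v i : ℝ) : ℂ) := by
      intro i
      rw [Complex.exp_mul_I, ← Complex.ofReal_cos, ← Complex.ofReal_sin]
      rcases hε with rfl | rfl
      · push_cast [one_mul]; ring
      · rw [neg_one_mul, Real.cos_neg, Real.sin_neg]; push_cast; ring
    simp only [h, Finset.sum_add_distrib, ← Finset.mul_sum, ← Complex.ofReal_sum, hcos, hsin]
    simp
  -- Factoring out the lowest frequency `-(2 k - 1)` turns the `2 k` conditions into a Vandermonde
  -- system with nodes `exp (2 i θ)`, distinct because the column indices are distinct modulo `2 n`.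
  set x : Fin (k * 2) → ℂ := fun i => Complex.exp (((2 * θ i : ℝ) : ℂ) * Complex.I) with hx
  set w : Fin (k * 2) → ℂ := fun i =>
    (v i : ℂ) * Complex.exp (((-(2 * k - 1) * θ i : ℝ) : ℂ) * Complex.I) with hw
  have hxinj : Function.Injective x := by
    intro i j hij
    obtain ⟨m, hm⟩ := Complex.exp_eq_exp_iff_exists_int.1 hij
    have h1 : 2 * θ i = 2 * θ j + m * (2 * Real.pi) := by
      have : (((2 * θ i : ℝ) : ℂ)) * Complex.I =
          ((2 * θ j + m * (2 * Real.pi) : ℝ) : ℂ) * Complex.I := by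
        rw [hm]; push_cast; ring
      exact_mod_cast mul_right_cancel₀ Complex.I_ne_zero this
    have h2 : ((e i : ℕ) : ℝ) = (e j : ℕ) + 2 * n * m := by
      have hpi := Real.pi_ne_zero
      simp only [hθ] at h1
      field_simp at h1
      linarith
    have h3 : ((e i : ℕ) : ℤ) = (e j : ℕ) + 2 * n * m := by exact_mod_cast h2
    have h4 : (2 * n : ℤ) ∣ (e i : ℕ) - (e j : ℕ) := ⟨m, by rw [h3]; ring⟩
    have := Int.eq_zero_of_abs_lt_dvd h4 (by rw [abs_lt]; omega)
    exact he (Fin.ext (by omega))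
  have hw0 : w = 0 := by
    refine Matrix.eq_zero_of_forall_pow_sum_mul_pow_eq_zero hxinj fun p => ?_
    have hterm : ∀ i, w i * x i ^ (p : ℕ) = (v i : ℂ) *
        Complex.exp ((((2 * (p : ℕ) - (2 * k - 1)) * θ i : ℝ) : ℂ) * Complex.I) := by
      intro i
      rw [hw, hx]
      simp only
      rw [← Complex.exp_nat_mul, mul_assoc, ← Complex.exp_add]
      congr 2
      push_cast
      ring
    simp only [hterm]
    have hp := p.2
    -- The power `p` has frequency `2 p - (2 k - 1)`, which is negative for `p < k` and comes from
    -- row pair `k - 1 - p`. Otherwise it comes from row pair `p - k`.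
    rcases lt_or_ge (p : ℕ) k with h | h
    · have h' := hexp ⟨k - 1 - p, by omega⟩ (-1) (Or.inr rfl)
      rw [← h']
      refine Finset.sum_congr rfl fun i _ => ?_
      have : ((k - 1 - p : ℕ) : ℝ) = k - 1 - (p : ℕ) := by
        rw [Nat.cast_sub (by omega), Nat.cast_sub (by omega)]; simp
      simp only [this]
      congr 4
      ring
    · have h' := hexp ⟨p - k, by omega⟩ 1 (Or.inl rfl)
      rw [← h']
      refine Finset.sum_congr rfl fun i _ => ?_
      have : ((p - k : ℕ) : ℝ) = (p : ℕ) - k := by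
        rw [Nat.cast_sub (by omega)]
      simp only [this]
      congr 4
      ring
  refine hv (funext fun i => ?_)
  have := congrFun hw0 i
  simpa [hw] using this

lemma det_pairRow_comp_perm_sq (O : Matrix (Fin (2 * n)) (Fin (2 * n)) ℝ) {k : ℕ}
    (j : Fin k → Fin n) (π : Equiv.Perm (Fin k)) (e : Fin (k * 2) → Fin (2 * n)) :
    (O.submatrix (pairRow (j ∘ π)) e).det ^ 2 = (O.submatrix (pairRow j) e).det ^ 2 := by
  set τ : Equiv.Perm (Fin (k * 2)) := finProdFinEquiv.permCongr (π.prodCongr (Equiv.refl _))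
    with hτ
  have h : O.submatrix (pairRow (j ∘ π)) e = (O.submatrix (pairRow j) e).submatrix τ id := by
    ext a b
    simp [hτ, pairRow, Equiv.permCongr_apply]
  rw [h, Matrix.det_permute, mul_pow]
  rcases Int.units_eq_one_or (Equiv.Perm.sign τ) with h | h <;> simp [h]

/-- A positive integer is at least `1`. The factor `k!` counts the orderings of the modes in `A`,
which do not affect the squared minor; tuples with a repeated mode have equal rows. -/
lemma le_sum_pairMinor_sq (hn : 0 < n) {k : ℕ} (hkn : k ≤ n) (S : DegSet n (k * 2)) :
    ((k.factorial * (8 * n) ^ k : ℝ))⁻¹ ≤ ∑ A, pairMinor (oddFourier n) S A ^ 2 := by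
  set e := S.1.orderEmbOfFin S.2 with he
  set F : (Fin k → Fin n) → ℝ := fun j => ((oddFourier n).submatrix (pairRow j) e).det ^ 2 with hF
  have hinj : ∀ j, ¬ Function.Injective j → F j = 0 := by
    intro j hj
    obtain ⟨a, b, hab, hne⟩ := by simpa [Function.Injective] using hj
    have hne' : finProdFinEquiv (a, (0 : Fin 2)) ≠ finProdFinEquiv (b, 0) :=
      fun h => hne (congrArg Prod.fst (finProdFinEquiv.injective h))
    rw [hF]
    simp only
    rw [Matrix.det_zero_of_row_eq hne', zero_pow two_ne_zero]
    funext c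
    simp [pairRow, hab]
  have hsum : ∑ j, F j = k.factorial * ∑ A, pairMinor (oddFourier n) S A ^ 2 := by
    rw [sum_eq_sum_subset_perm F hinj]
    have h1 : ∀ (A : {A : Finset (Fin n) // A.card = k}) (π : Equiv.Perm (Fin k)),
        F (A.1.orderEmbOfFin A.2 ∘ π) = pairMinor (oddFourier n) S A.1 ^ 2 := by
      intro A π
      rw [hF]
      simp only
      rw [det_pairRow_comp_perm_sq, pairMinor, dif_pos A.2]
    simp only [h1, Finset.sum_const, Finset.card_univ, Fintype.card_perm, Fintype.card_fin,
      nsmul_eq_mul, ← Finset.mul_sum]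
    congr 1
    rw [← Finset.sum_filter_of_ne (p := fun A : Finset (Fin n) => A.card = k)]
    · exact (Finset.sum_subtype _ (by simp) (fun A => pairMinor (oddFourier n) S A ^ 2)).symm
    · intro A _ hA
      by_contra h
      simp [pairMinor, h] at hA
  have hpos : 0 < ∑ j, F j := by
    refine Finset.sum_pos' (fun j _ => sq_nonneg _) ⟨Fin.castLE hkn, Finset.mem_univ _, ?_⟩
    have := det_oddFourier_castLE_ne_zero hkn hn (e := e) e.injective
    rw [hF]
    positivity
  obtain ⟨z, hz⟩ := sum_det_sq_mem_range hn (e : Fin (k * 2) → Fin (2 * n))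
  have hz' : (z : ℝ) = (8 * n : ℝ) ^ k * ∑ j, F j := hz
  have hz1 : (1 : ℝ) ≤ z := by
    have h0 : (0 : ℝ) < z := by rw [hz']; positivity
    exact_mod_cast Int.add_one_le_iff.2 (by exact_mod_cast h0 : (0 : ℤ) < z)
  rw [hz', hsum] at hz1
  rw [inv_le_iff_one_le_mul₀ (by positivity)]
  linarith

end OddFourier

/-! ### Response functions and attainment of the sharpness -/

section Sharpness

variable {n : ℕ} {Λ : Type*} [Fintype Λ]

lemma IsPostProcessing.isPOVM {d Ω : Type*} [Fintype d] [DecidableEq d] [Fintype Ω]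
    {G : Λ → Matrix d d ℂ} {M : Ω → Matrix d d ℂ} (hG : IsPOVM G) (h : IsPostProcessing G M) :
    IsPOVM M := by
  obtain ⟨D, hD, hD1, hM⟩ := h
  constructor
  · intro e
    rw [hM]
    refine Matrix.posSemidef_sum _ fun l _ => (hG.1 l).smul ?_
    exact_mod_cast (hD l e).1
  · simp only [hM]
    rw [Finset.sum_comm, ← hG.2]
    refine Finset.sum_congr rfl fun l _ => ?_
    rw [← Finset.sum_smul, ← Complex.ofReal_sum, hD1, Complex.ofReal_one, one_smul]

/-- A bounded response function with values in `[-1, 1]` yields an unsharp measurement. -/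
lemma isPostProcessing_unsharp {G : Λ → FockOp n} (hG : IsPOVM G) (S : Finset (Fin (2 * n)))
    {η : ℝ} (h : Λ → ℝ) (hb : ∀ l, |h l| ≤ 1)
    (hη : ∑ l, (h l : ℂ) • G l = (η : ℂ) • monomial S) : IsPostProcessing G (unsharp S η) := by
  refine ⟨fun l e => 1 / 2 * (1 + ((e : ℤ) : ℝ) * h l), ?_, ?_, ?_⟩
  · intro l e
    have := abs_le.1 (hb l)
    rcases Int.units_eq_one_or e with h' | h' <;> simp only [h'] <;> push_cast <;>
      constructor <;> linarith
  · intro l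
    rw [UnitsInt.univ, Finset.sum_pair (by decide)]
    push_cast
    ring
  · intro e
    have h1 : ∀ l, ((1 / 2 * (1 + ((e : ℤ) : ℝ) * h l) : ℝ) : ℂ) • G l =
        (1 / 2 : ℂ) • (G l + ((e : ℤ) : ℂ) • (h l : ℂ) • G l) := by
      intro l
      rw [smul_smul, ← one_smul ℂ (G l), smul_smul, smul_smul, ← add_smul, smul_smul]
      congr 1
      push_cast
      ring
    simp only [h1, ← Finset.smul_sum, Finset.sum_add_distrib, hη, hG.2]
    rw [unsharp, smul_smul]

/-- The response function `D(+1) - D(-1)` produces `η γ_S`; multiplying it by `η' / η` keeps it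
within `[-1, 1]`. -/
lemma IsPostProcessing.unsharp_of_le {G : Λ → FockOp n} (hG : IsPOVM G)
    {S : Finset (Fin (2 * n))} {η η' : ℝ} (h : IsPostProcessing G (unsharp S η)) (h0 : 0 ≤ η')
    (hle : η' ≤ η) : IsPostProcessing G (unsharp S η') := by
  obtain ⟨D, hD, hD1, hM⟩ := h
  have hsum : ∑ l, ((D l 1 - D l (-1) : ℝ) : ℂ) • G l = (η : ℂ) • monomial S := by
    simp only [Complex.ofReal_sub, sub_smul, Finset.sum_sub_distrib, ← hM, unsharp]
    rw [← smul_sub, add_sub_add_left_eq_sub, ← sub_smul, smul_smul]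
    congr 1
    push_cast
    ring
  rcases h0.eq_or_lt with rfl | hpos
  · exact isPostProcessing_unsharp hG S (fun _ => 0) (by simp) (by simp)
  have hηpos : 0 < η := hpos.trans_le hle
  refine isPostProcessing_unsharp hG S (fun l => η' / η * (D l 1 - D l (-1))) ?_ ?_
  · intro l
    have h1 := hD l 1
    have h2 := hD l (-1)
    rw [abs_mul, abs_of_nonneg (by positivity)]
    refine mul_le_one₀ ((div_le_one hηpos).2 hle) (abs_nonneg _) (abs_le.2 ⟨?_, ?_⟩) <;> linarith
  · simp only [Complex.ofReal_mul, mul_smul, ← Finset.smul_sum, hsum]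
    rw [smul_smul, ← Complex.ofReal_mul, div_mul_cancel₀ _ hηpos.ne']

/-- The supremum in the definition of the sharpness is attained. -/
lemma sharpness_mem {G : Λ → FockOp n} (hG : IsPOVM G) (S : Finset (Fin (2 * n))) :
    0 ≤ sharpness G S ∧ sharpness G S ≤ 1 ∧ IsPostProcessing G (unsharp S (sharpness G S)) := by
  -- The admissible pairs of a sharpness and a post-processing form a closed subset of a compact
  -- box, and the attainable sharpnesses are its projection.
  set K : Set (ℝ × (Λ → ℤˣ → ℝ)) := Set.Icc 0 1 ×ˢ
    Set.pi Set.univ fun _ => Set.pi Set.univ fun _ => Set.Icc 0 1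
  have hK : IsCompact K := isCompact_Icc.prod
    (isCompact_univ_pi fun _ => isCompact_univ_pi fun _ => isCompact_Icc)
  set C : Set (ℝ × (Λ → ℤˣ → ℝ)) := {p | (∀ l, ∑ e, p.2 l e = 1) ∧
    ∀ e, unsharp S p.1 e = ∑ l, (p.2 l e : ℂ) • G l} with hCdef
  have hC : IsClosed C := by
    rw [hCdef, Set.ofPred_and]
    refine IsClosed.inter ?_ ?_
    · simp only [Set.ofPred_forall]
      exact isClosed_iInter fun l => isClosed_eq (by fun_prop) continuous_const
    · simp only [Set.ofPred_forall]
      refine isClosed_iInter fun e => isClosed_eq ?_ ?_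
      · unfold unsharp; fun_prop
      · fun_prop
  have himg : {η : ℝ | 0 ≤ η ∧ η ≤ 1 ∧ IsPostProcessing G (unsharp S η)} =
      Prod.fst '' (K ∩ C) := by
    ext η
    constructor
    · rintro ⟨h0, h1, D, hD, hD1, hM⟩
      exact ⟨(η, D), ⟨⟨⟨h0, h1⟩, fun l _ e _ => hD l e⟩, hD1, hM⟩, rfl⟩
    · rintro ⟨⟨η, D⟩, ⟨⟨⟨h0, h1⟩, hD⟩, hD1, hM⟩, rfl⟩
      exact ⟨h0, h1, D, fun l e => hD l trivial e trivial, hD1, hM⟩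
  have hcomp : IsCompact {η : ℝ | 0 ≤ η ∧ η ≤ 1 ∧ IsPostProcessing G (unsharp S η)} := by
    rw [himg]
    exact (hK.inter_right hC).image continuous_fst
  exact hcomp.sSup_mem ⟨0, le_rfl, zero_le_one,
    isPostProcessing_unsharp hG S (fun _ => 0) (by simp) (by simp)⟩

lemma le_sharpness {G : Λ → FockOp n} {S : Finset (Fin (2 * n))} {η : ℝ} (h0 : 0 ≤ η) (h1 : η ≤ 1)
    (h : IsPostProcessing G (unsharp S η)) : η ≤ sharpness G S :=
  le_csSup ⟨1, fun _ hx => hx.2.1⟩ ⟨h0, h1, h⟩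

lemma jointlyMeasures_minSharpness {G : Λ → FockOp n} (hG : IsPOVM G) (m : ℕ) :
    JointlyMeasures G (fun S : DegSet n m => unsharp S.1 (minSharpness m G)) := by
  have h : ∀ S : DegSet n m, IsPostProcessing G (unsharp S.1 (minSharpness m G)) := fun S =>
    (sharpness_mem hG S.1).2.2.unsharp_of_le hG
      (Real.iInf_nonneg fun T : DegSet n m => (sharpness_mem hG T.1).1)
      (ciInf_le (Set.finite_range _).bddBelow S)
  exact ⟨hG, fun S => (h S).isPOVM hG, h⟩

end Sharpness

/-! ### The randomised measurement and the final bound -/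

section Randomised

variable {n N : ℕ}

lemma randomisedPOVM_isPOVM (hn : 0 < n) (hN : 0 < N)
    (O : Fin N → Matrix.orthogonalGroup (Fin (2 * n)) ℝ) : IsPOVM (randomisedPOVM O) := by
  have h : ∀ r, IsPOVM (parentPOVM (O r : Matrix (Fin (2 * n)) (Fin (2 * n)) ℝ)) := fun r =>
    parentPOVM_isPOVM hn ((Matrix.mem_orthogonalGroup_iff _ _).1 (O r).2)
  constructor
  · rintro ⟨r, l⟩
    refine ((h r).1 l).smul ?_
    rw [inv_nonneg]
    exact_mod_cast N.zero_le
  · have hN' : (N : ℂ) ≠ 0 := by exact_mod_cast hN.ne'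
    simp only [randomisedPOVM, Fintype.sum_prod_type (α₁ := Fin N), ← Finset.smul_sum, (h _).2]
    rw [Finset.sum_const, Finset.card_univ, Fintype.card_fin, ← Nat.cast_smul_eq_nsmul ℂ,
      smul_smul, inv_mul_cancel₀ hN', one_smul]

/-- The odd-frequency Fourier matrix as an orthogonal matrix. -/
noncomputable def oddFourierOrthogonal (hn : 0 < n) : Matrix.orthogonalGroup (Fin (2 * n)) ℝ :=
  ⟨oddFourier n, oddFourier_mem hn⟩

/-- The response function is the sign of the conditional expectation of `γ_S`. -/
lemma isPostProcessing_parentPOVM {O : Matrix (Fin (2 * n)) (Fin (2 * n)) ℝ} (hn : 0 < n)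
    (hO : O * Oᵀ = 1) {k : ℕ} (S : DegSet n (k * 2)) :
    IsPostProcessing (parentPOVM O) (unsharp S.1
      ((2 ^ n)⁻¹ * ∑ q : Fin n → ℤˣ, |signPoly Finset.univ (pairMinor O S) q|)) := by
  refine isPostProcessing_unsharp (parentPOVM_isPOVM hn hO) S.1
    -- The parity isolates `γ_S` in the sum over `X`, with coefficient proportional to `f_S(q)`; the
    -- sign turns this into `|f_S(q)|` so that different `q` do not cancel.
    (fun l => (SignType.sign (signPoly Finset.univ (pairMinor O S) l.1) : ℝ) * parity S.1 l.2)
    ?_ ?_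
  · intro l
    have h1 : |parity S.1 l.2| = 1 := by
      rcases parity_eq S.1 l.2 with h | h <;> simp [h]
    rw [abs_mul, h1, mul_one]
    rcases lt_trichotomy (signPoly Finset.univ (pairMinor O S) l.1) 0 with h | h | h <;> simp [h]
  · have hq : ∀ q, signPoly Finset.univ (pairMinor O S) q =
        ∑ A : Finset (Fin n), pairMinor O S A * ∏ j ∈ A, ((q j : ℤ) : ℝ) := by
      intro q
      rw [signPoly, Finset.powerset_univ]
    simp only [Fintype.sum_prod_type, Complex.ofReal_mul, mul_smul, ← Finset.smul_sum,
      sum_parity_smul_parentPOVM hn hO S, ← hq]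
    simp only [smul_smul, ← Finset.sum_smul]
    congr 1
    push_cast
    rw [Finset.mul_sum]
    refine Finset.sum_congr rfl fun q _ => ?_
    rw [← sign_mul_self]
    push_cast
    ring

/-- When all randomised measurements coincide, the post-processing can ignore the index `r`, and the
`N` weights `1 / N` add up to `1`. -/
lemma IsPostProcessing.randomised (hN : 0 < N) (O : Matrix.orthogonalGroup (Fin (2 * n)) ℝ)
    {Ω : Type*} [Fintype Ω] {M : Ω → FockOp n}
    (h : IsPostProcessing (parentPOVM (O : Matrix (Fin (2 * n)) (Fin (2 * n)) ℝ)) M) :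
    IsPostProcessing (randomisedPOVM fun _ : Fin N => O) M := by
  obtain ⟨D, hD, hD1, hM⟩ := h
  have hN' : (N : ℂ) ≠ 0 := by exact_mod_cast hN.ne'
  refine ⟨fun l => D l.2, fun l => hD l.2, fun l => hD1 l.2, fun e => ?_⟩
  simp only [randomisedPOVM, Fintype.sum_prod_type (α₁ := Fin N), smul_comm _ (N : ℂ)⁻¹,
    ← Finset.smul_sum, ← hM]
  rw [Finset.sum_const, Finset.card_univ, Fintype.card_fin, ← Nat.cast_smul_eq_nsmul ℂ,
    smul_smul, inv_mul_cancel₀ hN', one_smul]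

/-- The constant of the lower bound on the sharpness for degree `2 k`. -/
noncomputable def sharpnessConst (k : ℕ) : ℝ := (√(k.factorial * 8 ^ k))⁻¹ / (3 * 3 ^ k)

lemma sharpnessConst_pos (k : ℕ) : 0 < sharpnessConst k := by
  unfold sharpnessConst; positivity

lemma rpow_neg_half (k : ℕ) : (n : ℝ) ^ (-(k : ℝ) / 2) = (√((n : ℝ) ^ k))⁻¹ := by
  rw [Real.sqrt_eq_rpow, ← Real.rpow_natCast, ← Real.rpow_mul (by positivity),
    ← Real.rpow_neg (by positivity)]
  congr 1
  ring

lemma sharpnessConst_mul_eq (k : ℕ) : sharpnessConst k * (n : ℝ) ^ (-(k : ℝ) / 2) =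
    √((k.factorial * (8 * n) ^ k : ℝ))⁻¹ / (3 * 3 ^ k) := by
  rw [rpow_neg_half, sharpnessConst, mul_pow, ← mul_assoc, Real.sqrt_inv,
    Real.sqrt_mul (by positivity) ((n : ℝ) ^ k), mul_inv]
  ring

lemma sharpnessConst_mul_le_one (hn : 0 < n) (k : ℕ) :
    sharpnessConst k * (n : ℝ) ^ (-(k : ℝ) / 2) ≤ 1 := by
  have h1 : (1 : ℝ) ≤ k.factorial := by exact_mod_cast k.factorial_pos
  have hn1 : (1 : ℝ) ≤ n := by exact_mod_cast hn
  have h2 : (1 : ℝ) ≤ (8 * n) ^ k := one_le_pow₀ (by linarith)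
  have h3 : (1 : ℝ) ≤ 3 ^ k := one_le_pow₀ (by norm_num)
  rw [sharpnessConst_mul_eq, div_le_one (by positivity)]
  have h4 : √((k.factorial * (8 * n) ^ k : ℝ))⁻¹ ≤ 1 :=
    Real.sqrt_le_one.2 (inv_le_one_of_one_le₀ (one_le_mul_of_one_le_of_one_le h1 h2))
  linarith

lemma jointlyMeasures_oddFourier {k : ℕ} (hk : k ≤ n) (hn : 0 < n) (hN : 0 < N) :
    ∃ O : Fin N → Matrix.orthogonalGroup (Fin (2 * n)) ℝ,
      JointlyMeasures (randomisedPOVM O) (fun S : DegSet n (2 * k) =>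
        unsharp S.1 (minSharpness (2 * k) (randomisedPOVM O))) ∧
      sharpnessConst k * (n : ℝ) ^ (-(k : ℝ) / 2) ≤
        minSharpness (2 * k) (randomisedPOVM O) := by
  refine ⟨fun _ => oddFourierOrthogonal hn, ?_, ?_⟩
  · exact jointlyMeasures_minSharpness (randomisedPOVM_isPOVM hn hN _) _
  have hO : oddFourier n * (oddFourier n)ᵀ = 1 :=
    (Matrix.mem_orthogonalGroup_iff _ _).1 (oddFourier_mem hn)
  have hne : Nonempty (DegSet n (2 * k)) := by
    obtain ⟨S, -, hS⟩ := Finset.exists_subset_card_eq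
      (show 2 * k ≤ (Finset.univ : Finset (Fin (2 * n))).card by simp; omega)
    exact ⟨⟨S, hS⟩⟩
  refine le_ciInf fun ⟨S, hS⟩ => ?_
  set T : DegSet n (k * 2) := ⟨S, by rw [hS, mul_comm]⟩ with hT
  have hpp := isPostProcessing_parentPOVM hn hO T
  have hle : sharpnessConst k * (n : ℝ) ^ (-(k : ℝ) / 2) ≤
      (2 ^ n)⁻¹ * ∑ q : Fin n → ℤˣ, |signPoly Finset.univ (pairMinor (oddFourier n) T) q| := by
    have h1 := le_sum_abs_signPoly (pairMinor (oddFourier n) T) k fun A hA => by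
      by_contra h
      exact hA (by rw [pairMinor, dif_neg (by omega)])
    rw [Fintype.card_fin] at h1
    rw [inv_mul_eq_div, le_div_iff₀ (by positivity), mul_comm, sharpnessConst_mul_eq]
    refine le_trans ?_ h1
    gcongr
    exact le_sum_pairMinor_sq hn hk T
  have h0 : 0 ≤ sharpnessConst k * (n : ℝ) ^ (-(k : ℝ) / 2) :=
    mul_nonneg (sharpnessConst_pos k).le (by positivity)
  refine le_sharpness h0 (sharpnessConst_mul_le_one hn k) ?_
  exact (hpp.unsharp_of_le (parentPOVM_isPOVM hn hO) h0 hle).randomised hN (oddFourierOrthogonal hn)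

end Randomised

end FermionicJM

theorem theorem1 :
    (∀ k : ℕ, 1 ≤ k → ∃ c : ℝ, 0 < c ∧ ∃ n₀ : ℕ, ∀ n : ℕ, n₀ < n → ∀ N : ℕ, 4 * k < N →
      ∃ O : Fin N → Matrix.orthogonalGroup (Fin (2 * n)) ℝ,
        FermionicJM.JointlyMeasures (FermionicJM.randomisedPOVM O)
          (fun S : FermionicJM.DegSet n (2 * k) =>
            FermionicJM.unsharp S.1
              (FermionicJM.minSharpness (2 * k) (FermionicJM.randomisedPOVM O))) ∧
        c * (n : ℝ) ^ (-(k : ℝ) / 2) ≤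
          FermionicJM.minSharpness (2 * k) (FermionicJM.randomisedPOVM O)) ∧
    (∃ c : ℝ, 0 < c ∧ ∃ n₀ : ℕ, ∀ n : ℕ, n₀ < n →
      ∃ O : Fin 2 → Matrix.orthogonalGroup (Fin (2 * n)) ℝ,
        FermionicJM.JointlyMeasures (FermionicJM.randomisedPOVM O)
          (fun S : FermionicJM.DegSet n 2 =>
            FermionicJM.unsharp S.1
              (FermionicJM.minSharpness 2 (FermionicJM.randomisedPOVM O))) ∧
        c * (n : ℝ) ^ (-(1 : ℝ) / 2) ≤
          FermionicJM.minSharpness 2 (FermionicJM.randomisedPOVM O)) := by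
  -- The threshold `n₀ = k` guarantees that the `k` lowest frequencies exist.
  refine ⟨fun k _ => ⟨_, FermionicJM.sharpnessConst_pos k, k, fun n hn N hN =>
    FermionicJM.jointlyMeasures_oddFourier hn.le (by omega) (by omega)⟩,
    _, FermionicJM.sharpnessConst_pos 1, 1, fun n hn => ?_⟩
  have h := FermionicJM.jointlyMeasures_oddFourier (n := n) (N := 2) (k := 1) hn.le (by omega)
    (by omega)
  rw [Nat.cast_one] at h
  exact h
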